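/- Let $q>0$ and $n>1$ be coprime integers and let $S=\operatorname{Spec}\mathbb Z[\tfrac1{nq}][z_1,\dots,z_n,(z_i-z_j)^{-1}\ (i<j)]$. Let $W\to S$ be the affine curve $y^q=P(x)=\prod_{i=1}^n(x-z_i)$, let $\rho:X\to\mathbb P^1_S$ be the normalization of $\mathbb P^1_S$ in $W$ with respect to $x$ (so that $X\to S$ is a smooth projective family of curves and $X\setminus W$ is one section $D_\infty$), let $D_i\subset X$ be the section $x=z_i$, $y=0$, and put $X^\circ=X\setminus(D_1\cup\dots\cup D_n\cup D_\infty)$. Fix an integer $r$ with $1\le r\le q-1$ and put $N=\prod_a(qa-nr)$, the product over the integers $a$ with $0\le a\le rn/q$. Fix $1\le k\le n$ and an integer $1\le j\le\left[\frac{n(q-r)}q\right]$. Consider the forms $$\omega_k^{(r)}=\frac{dx}{y^r(x-z_k)},\qquad \mu_j^{(q-r)}=\frac{x^{j-1}dx}{y^{q-r}} .$$ The form $\mu_j^{(q-r)}$ is a regular relative $1$-form on $X$, and $[\mu_j^{(q-r)}]$ denotes its class in $H^1_{dR}(X/S)$. There is a class $[\omega_k^{(r)}]\in H^1_{dR}(X/S)\otimes\mathbb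 Z[N^{-1}]$ whose restriction to $H^1_{dR}(X^\circ_{\mathbb Q}/S)$ is represented by $\omega_k^{(r)}$. The Poincaré pairing of $X/S$ is the cup product $H^1_{dR}(X/S)\otimes H^1_{dR}(X/S)\to H^2_{dR}(X/S)$ followed by a trace isomorphism $H^2_{dR}(X/S)\otimes\mathbb Z[N^{-1}]\cong\mathcal O(S)[N^{-1}]$. For a cover $X=U_1\cup U_2$ by open sets, classes are represented by triples $(\alpha,\beta,\gamma)$ with $\alpha\in\Omega^1(U_1)$, $\beta\in\Omega^1(U_2)$, $\gamma\in\mathcal O(U_1\cap U_2)$, $d\gamma=\alpha-\beta$; the cup product of $(\alpha_1,\beta_1,\gamma_1)$ and $(\alpha_2,\beta_2,\gamma_2)$ is the class of the form $\gamma_1\beta_2-\gamma_2\alpha_1$ on $U_1\cap U_2$. Let $\langle\ ,\ \rangle_X$ be the pairing for which the trace of a form on $U_1\cap U_2$ is the sum of its residues (on the curves $X_s$, $s\in S$) along $X\setminus U_1$, and let $(\ ,\ )=\frac1q\langle\ ,\ \rangle_X$ be the pairing for which the trace is normalized by the trace of $\mathbb P^1_S$, i.e. for which $H^2_{dR}(\mathbb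 P^1_S/S)\xrightarrow{\rho^*}H^2_{dR}(X/S)\to\mathcal O_S$ is the trace of $\mathbb P^1_S$. **Theorem.** With $C_k(z)=\prod_{i\ne k}(z_k-z_i)$, every class $[\omega_k^{(r)}]\in H^1_{dR}(X/S)\otimes\mathbb Z[N^{-1}]$ as above satisfies, in $\mathcal O(S)[N^{-1}]$ (where $rC_k(z)$ is invertible), $$([\omega_k^{(r)}],[\mu_j^{(q-r)}])=-\frac{q}{r\,C_k(z)}\,z_k^{j-1},\qquad\text{equivalently}\qquad \langle[\omega_k^{(r)}],[\mu_j^{(q-r)}]\rangle_X=-\frac{q^2}{r\,C_k(z)}\,z_k^{j-1}.$$ -/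

import Mathlib

noncomputable section

open Polynomial LaurentSeries
open scoped KaehlerDifferential

namespace CyclicCurve

variable {R : Type*} [CommRing R]

/-- The derivation `t · d/dt` of the Laurent series ring `R((t))`. -/
def euler (R : Type*) [CommRing R] : R⸨X⸩ →ₗ[R] R⸨X⸩ where
  toFun f :=
    { coeff := fun m => (m : R) * f.coeff m
      isPWO_support' := f.isPWO_support.mono fun m hm h => hm (by simp [h]) }
  map_add' f g := by ext m; simp [mul_add]
  map_smul' r f := by ext m; simp; ring

theorem euler_coeff (f : R⸨X⸩) (m : ℤ) : (euler R f).coeff m = (m : R) * f.coeff m := rfl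

theorem euler_support (f : R⸨X⸩) : (euler R f).support ⊆ f.support :=
  fun m hm h => hm (by simp [euler_coeff, h])

theorem euler_mul (f g : R⸨X⸩) : euler R (f * g) = f * euler R g + g * euler R f := by
  ext m
  rw [mul_comm g, HahnSeries.coeff_add, euler_coeff, HahnSeries.coeff_mul,
    HahnSeries.coeff_mul_right' g.isPWO_support (euler_support g),
    HahnSeries.coeff_mul_left' f.isPWO_support (euler_support f), Finset.mul_sum,
    ← Finset.sum_add_distrib]
  refine Finset.sum_congr rfl fun ij hij => ?_
  rw [Finset.mem_antidiagonal] at hij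
  rw [← hij.2.2, euler_coeff, euler_coeff]
  push_cast
  ring

theorem euler_C (r : R) : euler R (HahnSeries.C r : R⸨X⸩) = 0 := by
  ext m
  rw [euler_coeff]
  by_cases h : m = 0
  · simp [h]
  · simp [HahnSeries.C_apply, HahnSeries.coeff_single_of_ne h]

theorem euler_pow (f : R⸨X⸩) (m : ℕ) :
    euler R (f ^ m) = (m : R⸨X⸩) * f ^ (m - 1) * euler R f := by
  induction m with
  | zero => simpa using euler_C (1 : R)
  | succ m ih =>
    rw [pow_succ, euler_mul, ih]
    cases m with
    | zero => simp
    | succ m => simp only [Nat.add_sub_cancel, pow_succ]; push_cast; ring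

theorem euler_single (m : ℤ) (r : R) :
    euler R (HahnSeries.single m r) = HahnSeries.single m ((m : R) * r) := by
  ext k
  rw [euler_coeff]
  by_cases h : k = m
  · subst h; simp
  · simp [HahnSeries.coeff_single_of_ne h]

/-! ### The two affine charts of the curve and their intersection -/

section Charts

variable {n : ℕ} (z : Fin n → R) (q : ℕ)

/-- The polynomial `P(x) = ∏ᵢ (x - zᵢ)`. -/
def branchPoly : R[X] := ∏ i, (X - C (z i))

/-- The coordinate ring `R[x, y] / (y ^ q - P(x))` of the affine curve `W`. -/
def AffRing : Type _ := AdjoinRoot (X ^ q - C (branchPoly z) : R[X][X])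

instance : CommRing (AffRing z q) :=
  inferInstanceAs (CommRing (AdjoinRoot (X ^ q - C (branchPoly z) : R[X][X])))

instance : Algebra R (AffRing z q) :=
  inferInstanceAs (Algebra R (AdjoinRoot (X ^ q - C (branchPoly z) : R[X][X])))

/-- The quotient map `R[x][y] → R[x, y] / (y ^ q - P(x))`. -/
def mkAff : R[X][X] →+* AffRing z q := AdjoinRoot.mk (X ^ q - C (branchPoly z) : R[X][X])

theorem mkAff_surjective : Function.Surjective (mkAff z q) := AdjoinRoot.mk_surjective

theorem mkAff_eq_zero (p : R[X][X]) : mkAff z q p = 0 ↔ X ^ q - C (branchPoly z) ∣ p :=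
  AdjoinRoot.mk_eq_zero

theorem algebraMap_aff (r : R) : algebraMap R (AffRing z q) r = mkAff z q (C (C r)) := rfl

/-- The coordinate function `x` on `W`. -/
def xAff : AffRing z q := mkAff z q (C X)

/-- The coordinate function `y` on `W`. -/
def yAff : AffRing z q := mkAff z q X

/-- The coordinate ring of the open curve `X° = {y ≠ 0} ⊆ W`, the complement of the ramification
points `D₁, …, Dₙ, D_∞`. -/
def OpenRing : Type _ := Localization.Away (yAff z q)

instance : CommRing (OpenRing z q) := inferInstanceAs (CommRing (Localization.Away (yAff z q)))

instance : Algebra (AffRing z q) (OpenRing z q) :=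
  inferInstanceAs (Algebra (AffRing z q) (Localization.Away (yAff z q)))

instance : Algebra R (OpenRing z q) :=
  inferInstanceAs (Algebra R (Localization.Away (yAff z q)))

instance : IsScalarTower R (AffRing z q) (OpenRing z q) :=
  inferInstanceAs (IsScalarTower R (AffRing z q) (Localization.Away (yAff z q)))

instance : IsLocalization.Away (yAff z q) (OpenRing z q) :=
  inferInstanceAs (IsLocalization.Away (yAff z q) (Localization.Away (yAff z q)))

/-- The function `x` on `X°`. -/
def xOpen : OpenRing z q := algebraMap (AffRing z q) _ (xAff z q)

/-- The function `y` on `X°`. -/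
def yOpen : OpenRing z q := algebraMap (AffRing z q) _ (yAff z q)

/-- The function `1 / y` on `X°`. -/
def yInv : OpenRing z q := IsLocalization.Away.invSelf (yAff z q)

theorem yOpen_mul_yInv : yOpen z q * yInv z q = 1 :=
  IsLocalization.Away.mul_invSelf (yAff z q)

theorem yAff_pow : yAff z q ^ q = ∏ i, (xAff z q - algebraMap R _ (z i)) := by
  have h := (mkAff_eq_zero z q _).2 (dvd_refl (X ^ q - C (branchPoly z)))
  rw [map_sub, map_pow, sub_eq_zero] at h
  rw [yAff, h, branchPoly, map_prod, map_prod]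
  refine Finset.prod_congr rfl fun i _ => ?_
  rw [map_sub, map_sub, algebraMap_aff, xAff]

/-- The function `1 / (x - z_k)` on `X°`, written as `y ^ (-q) ∏_{i ≠ k} (x - zᵢ)`. -/
def subInv (k : Fin n) : OpenRing z q :=
  yInv z q ^ q * ∏ i ∈ Finset.univ.erase k, (xOpen z q - algebraMap R _ (z i))

theorem sub_mul_subInv (k : Fin n) :
    (xOpen z q - algebraMap R _ (z k)) * subInv z q k = 1 := by
  have h := congrArg (algebraMap (AffRing z q) (OpenRing z q)) (yAff_pow z q)
  rw [map_pow, map_prod] at h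
  simp only [map_sub, ← IsScalarTower.algebraMap_apply] at h
  rw [subInv, mul_left_comm, Finset.mul_prod_erase Finset.univ
    (fun i => xOpen z q - algebraMap R (OpenRing z q) (z i)) (Finset.mem_univ k)]
  change yInv z q ^ q * ∏ i, (algebraMap (AffRing z q) (OpenRing z q) (xAff z q) - _) = 1
  rw [← h, mul_comm, ← mul_pow]
  change (yOpen z q * yInv z q) ^ q = 1
  rw [yOpen_mul_yInv, one_pow]

/-- The coordinate ring of the affine open curve `V = X \ (D₁ ∪ … ∪ Dₙ) = X° ∪ D_∞`, as a subring
of the coordinate ring of `X°`. The functions `x` and `y` have poles of order `q` and `n` along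
`D_∞`, so that a monomial `x ^ i * y ^ (-m)` is regular along `D_∞` when `q * i ≤ n * m`, and
(`q` and `n` being coprime) the regular functions on `V` are the `R`-linear combinations of these
monomials. -/
def InfRing : Subalgebra R (OpenRing z q) :=
  Algebra.adjoin R {f | ∃ i m : ℕ, q * i ≤ n * m ∧ f = xOpen z q ^ i * yInv z q ^ m}

/-- Restriction of relative `1`-forms from `W` to `X°`. -/
def resAff : Ω[AffRing z q⁄R] →ₗ[R] Ω[OpenRing z q⁄R] :=
  (KaehlerDifferential.map R R (AffRing z q) (OpenRing z q)).restrictScalars R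

/-- Restriction of relative `1`-forms from `V` to `X°`. -/
def resInf : Ω[InfRing z q⁄R] →ₗ[R] Ω[OpenRing z q⁄R] :=
  (KaehlerDifferential.map R R (InfRing z q) (OpenRing z q)).restrictScalars R


/-! ### Relative de Rham cohomology -/

/-- The group of Čech `1`-cochains, for the cover `X = W ∪ V`, of the relative de Rham complex
`𝒪_X → Ω¹_{X/S}`: triples `(α, β, γ)` of a form on `W`, a form on `V` and a function on
`X° = W ∩ V`. -/
abbrev Cochain : Type _ := Ω[AffRing z q⁄R] × Ω[InfRing z q⁄R] × OpenRing z q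

/-- The differential `(α, β, γ) ↦ α - β - dγ` from `1`-cochains to `2`-cochains. -/
def cochainDiff : Cochain z q →ₗ[R] Ω[OpenRing z q⁄R] :=
  LinearMap.coprod (resAff z q) (LinearMap.coprod (-resInf z q)
    (-(KaehlerDifferential.D R (OpenRing z q)).toLinearMap))

theorem cochainDiff_apply (a : Cochain z q) : cochainDiff z q a =
    resAff z q a.1 - resInf z q a.2.1 - KaehlerDifferential.D R (OpenRing z q) a.2.2 := by
  simp [cochainDiff, sub_eq_add_neg, add_assoc]

/-- The differential `(f, g) ↦ (df, dg, f - g)` from `0`-cochains to `1`-cochains. -/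
def cochainDiffZero : AffRing z q × InfRing z q →ₗ[R] Cochain z q :=
  LinearMap.prod ((KaehlerDifferential.D R (AffRing z q)).toLinearMap ∘ₗ LinearMap.fst R _ _)
    (LinearMap.prod ((KaehlerDifferential.D R (InfRing z q)).toLinearMap ∘ₗ LinearMap.snd R _ _)
      (LinearMap.coprod (IsScalarTower.toAlgHom R (AffRing z q) (OpenRing z q)).toLinearMap
        (-(InfRing z q).val.toLinearMap)))

theorem cochainDiffZero_apply (f : AffRing z q) (g : InfRing z q) : cochainDiffZero z q (f, g) =
    (KaehlerDifferential.D R _ f, KaehlerDifferential.D R _ g,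
      algebraMap (AffRing z q) (OpenRing z q) f - (g : OpenRing z q)) := by
  simp [cochainDiffZero, sub_eq_add_neg]

/-- The module of `1`-cocycles: triples `(α, β, γ)` with `dγ = α - β` on `X°`. -/
def Cocycle : Submodule R (Cochain z q) := LinearMap.ker (cochainDiff z q)

/-- The submodule of `1`-coboundaries `(df, dg, f - g)` in the module of `1`-cocycles. -/
def Coboundary : Submodule R (Cocycle z q) :=
  (LinearMap.range (cochainDiffZero z q)).submoduleOf (Cocycle z q)

theorem mem_coboundary (a : Cocycle z q) : a ∈ Coboundary z q ↔
    ∃ (f : AffRing z q) (g : InfRing z q), (a : Cochain z q) =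
      (KaehlerDifferential.D R _ f, KaehlerDifferential.D R _ g,
        algebraMap (AffRing z q) (OpenRing z q) f - (g : OpenRing z q)) := by
  rw [Coboundary, Submodule.submoduleOf, Submodule.mem_comap, LinearMap.mem_range]
  constructor
  · rintro ⟨⟨f, g⟩, hfg⟩
    exact ⟨f, g, by rw [← cochainDiffZero_apply, hfg]; rfl⟩
  · rintro ⟨f, g, hfg⟩
    exact ⟨(f, g), by rw [cochainDiffZero_apply, ← hfg]; rfl⟩

/-- The relative de Rham cohomology `H¹_dR(X/S)`, the first hypercohomology of
`𝒪_X → Ω¹_{X/S}`, computed by the cover of `X` by the affine open curves `W` and `V`. -/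
abbrev H1dR : Type _ := Cocycle z q ⧸ Coboundary z q

/-- The relative de Rham cohomology `H¹_dR(X°/S)` of the affine curve `X°`. -/
abbrev H1dROpen : Type _ :=
  Ω[OpenRing z q⁄R] ⧸ LinearMap.range (KaehlerDifferential.D R (OpenRing z q)).toLinearMap

theorem resAff_D (f : AffRing z q) : resAff z q (KaehlerDifferential.D R _ f) =
    KaehlerDifferential.D R (OpenRing z q) (algebraMap (AffRing z q) (OpenRing z q) f) :=
  KaehlerDifferential.map_D R R (AffRing z q) (OpenRing z q) f

theorem resInf_D (g : InfRing z q) : resInf z q (KaehlerDifferential.D R _ g) =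
    KaehlerDifferential.D R (OpenRing z q) (g : OpenRing z q) :=
  KaehlerDifferential.map_D R R (InfRing z q) (OpenRing z q) g

/-- The restriction map `H¹_dR(X/S) → H¹_dR(X°/S)`, `[(α, β, γ)] ↦ [α|X°]`. -/
def restrictOpen : H1dR z q →ₗ[R] H1dROpen z q :=
  Submodule.liftQ _ (Submodule.mkQ _ ∘ₗ resAff z q ∘ₗ LinearMap.fst R _ _ ∘ₗ
    (Cocycle z q).subtype) (by
      intro a ha
      obtain ⟨f, g, hfg⟩ := (mem_coboundary z q a).1 ha
      rw [LinearMap.mem_ker]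
      simp only [LinearMap.comp_apply, Submodule.subtype_apply]
      rw [hfg, LinearMap.fst_apply, resAff_D, Submodule.mkQ_apply,
        Submodule.Quotient.mk_eq_zero]
      exact ⟨_, rfl⟩)

/-- The module `H⁰(X, Ω¹_{X/S})` of global regular relative `1`-forms on `X`. -/
def GlobalForm : Submodule R (Ω[AffRing z q⁄R] × Ω[InfRing z q⁄R]) :=
  LinearMap.eqLocus (resAff z q ∘ₗ LinearMap.fst R _ _) (resInf z q ∘ₗ LinearMap.snd R _ _)

/-- The map `H⁰(X, Ω¹_{X/S}) → H¹_dR(X/S)` sending a global regular `1`-form to its class. -/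
def classOfForm : GlobalForm z q →ₗ[R] H1dR z q :=
  Submodule.mkQ _ ∘ₗ LinearMap.codRestrict (Cocycle z q)
    (LinearMap.prod (LinearMap.fst R _ _ ∘ₗ (GlobalForm z q).subtype)
      (LinearMap.prod (LinearMap.snd R _ _ ∘ₗ (GlobalForm z q).subtype) 0))
    (by
      rintro ⟨⟨α, β⟩, h⟩
      have h' : resAff z q α = resInf z q β := h
      rw [Cocycle, LinearMap.mem_ker, cochainDiff_apply]
      simp [h'])

/-- The relative `1`-form `dx / (y ^ r (x - z_k))` on `X°`. -/
def omegaForm (r : ℕ) (k : Fin n) : Ω[OpenRing z q⁄R] :=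
  (yInv z q ^ r * subInv z q k) • KaehlerDifferential.D R (OpenRing z q) (xOpen z q)

/-- The relative `1`-form `x ^ (j - 1) dx / y ^ r` on `X°`. -/
def muForm (r j : ℕ) : Ω[OpenRing z q⁄R] :=
  (yInv z q ^ r * xOpen z q ^ (j - 1)) • KaehlerDifferential.D R (OpenRing z q) (xOpen z q)

/-- The class `c ∈ H¹_dR(X/S)` restricts to the class of the form `ω` in
`H¹_dR(X°_ℚ/S) = ℚ ⊗ H¹_dR(X°/S)`. -/
def RestrictsTo (c : H1dR z q) (ω : Ω[OpenRing z q⁄R]) : Prop :=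
  (TensorProduct.tmul ℤ (1 : ℚ) (restrictOpen z q c) : TensorProduct ℤ ℚ (H1dROpen z q)) =
    TensorProduct.tmul ℤ (1 : ℚ) (Submodule.Quotient.mk ω)

/-! ### Expansion and residue at the point at infinity -/

/-- The numerical conditions on the family: `q > 0` is prime to `n` and invertible on the base. -/
structure Admissible (R : Type*) [CommRing R] (n q : ℕ) : Prop where
  pos : 0 < q
  coprime : Nat.Coprime q n
  isUnit : IsUnit (q : R)

variable {q}

theorem exists_root (h : Admissible R n q) : ∃ w : PowerSeries R,
    w ^ q = ∏ i, (1 - PowerSeries.C (z i) * PowerSeries.X) ∧ PowerSeries.constantCoeff w = 1 := by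
  have hH : HenselianRing (PowerSeries R) (Ideal.span {(PowerSeries.X : PowerSeries R)}) :=
    inferInstance
  obtain ⟨w, hw, hw1⟩ := hH.is_henselian
    (X ^ q - C (∏ i, (1 - PowerSeries.C (z i) * PowerSeries.X) : PowerSeries R))
    (monic_X_pow_sub_C _ h.pos.ne') 1
    (by
      rw [eval_sub, eval_pow, eval_X, eval_C, one_pow, Ideal.mem_span_singleton,
        PowerSeries.X_dvd_iff]
      simp)
    (by
      have h1 : IsUnit (((q : ℕ) : PowerSeries R)) := by
        simpa using h.isUnit.map (PowerSeries.C (R := R))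
      rw [derivative_sub, derivative_X_pow, derivative_C, sub_zero]
      simpa using h1.map (Ideal.Quotient.mk (Ideal.span {(PowerSeries.X : PowerSeries R)})))
  refine ⟨w, ?_, ?_⟩
  · rw [IsRoot, eval_sub, eval_pow, eval_X, eval_C, sub_eq_zero] at hw
    exact hw
  · rw [Ideal.mem_span_singleton, PowerSeries.X_dvd_iff] at hw1
    simpa [sub_eq_zero] using hw1

/-- The `q`-th root `w(s)` of `∏ᵢ (1 - zᵢ s)` with constant term `1`. -/
def rootSeries (h : Admissible R n q) : PowerSeries R := (exists_root z h).choose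

theorem rootSeries_pow (h : Admissible R n q) :
    rootSeries z h ^ q = ∏ i, (1 - PowerSeries.C (z i) * PowerSeries.X) :=
  (exists_root z h).choose_spec.1

theorem constantCoeff_rootSeries (h : Admissible R n q) :
    PowerSeries.constantCoeff (rootSeries z h) = 1 :=
  (exists_root z h).choose_spec.2

/-- The power series `w(t ^ q)`. -/
def rootExp (h : Admissible R n q) : PowerSeries R :=
  PowerSeries.expand q h.pos.ne' (rootSeries z h)

theorem isUnit_rootExp (h : Admissible R n q) : IsUnit (rootExp z h) := by
  rw [PowerSeries.isUnit_iff_constantCoeff, rootExp, PowerSeries.constantCoeff_expand,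
    constantCoeff_rootSeries]
  exact isUnit_one

/-- The expansion `t ^ (-q)` of `x` at `D_∞`. -/
def xExp (R : Type*) [CommRing R] (q : ℕ) : R⸨X⸩ := HahnSeries.single (-(q : ℤ)) 1

/-- The expansion `t ^ (-n) w(t ^ q)` of `y` at `D_∞`. -/
def yExp (h : Admissible R n q) : R⸨X⸩ :=
  HahnSeries.single (-(n : ℤ)) 1 * HahnSeries.ofPowerSeries ℤ R (rootExp z h)

theorem yExp_pow (h : Admissible R n q) :
    yExp z h ^ q = ∏ i, (xExp R q - HahnSeries.C (z i)) := by
  have h1 : HahnSeries.ofPowerSeries ℤ R (rootExp z h) ^ q =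
      ∏ i, (1 - HahnSeries.C (z i) * HahnSeries.single (q : ℤ) 1) := by
    rw [← map_pow, rootExp, ← map_pow, rootSeries_pow, map_prod, map_prod]
    refine Finset.prod_congr rfl fun i _ => ?_
    simp [PowerSeries.expand_C, PowerSeries.expand_X, HahnSeries.ofPowerSeries_C]
  have h2 : (HahnSeries.single (-(n : ℤ)) (1 : R)) ^ q = ∏ _i : Fin n, xExp R q := by
    simp [xExp, HahnSeries.single_pow, mul_comm]
  rw [yExp, mul_pow, h1, h2, ← Finset.prod_mul_distrib]
  refine Finset.prod_congr rfl fun i _ => ?_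
  rw [mul_sub, mul_one, mul_left_comm, xExp, HahnSeries.single_mul_single]
  simp

theorem isUnit_yExp (h : Admissible R n q) : IsUnit (yExp z h) := by
  refine IsUnit.mul (IsUnit.of_mul_eq_one (HahnSeries.single (n : ℤ) 1) ?_)
    ((isUnit_rootExp z h).map _)
  rw [HahnSeries.single_mul_single]
  simp

/-- Expansion at `D_∞` of functions on `W`. -/
def expandAff (h : Admissible R n q) : AffRing z q →+* R⸨X⸩ :=
  AdjoinRoot.lift (eval₂RingHom HahnSeries.C (xExp R q)) (yExp z h) (by
    rw [eval₂_sub, eval₂_pow, eval₂_X, eval₂_C, yExp_pow, sub_eq_zero, branchPoly, map_prod]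
    simp)

theorem expandAff_mkAff (h : Admissible R n q) (p : R[X][X]) : expandAff z h (mkAff z q p) =
    eval₂ (eval₂RingHom HahnSeries.C (xExp R q)) (yExp z h) p := AdjoinRoot.lift_mk _ p

theorem expandAff_x (h : Admissible R n q) : expandAff z h (xAff z q) = xExp R q := by
  simp [expandAff_mkAff, xAff]

theorem expandAff_y (h : Admissible R n q) : expandAff z h (yAff z q) = yExp z h := by
  simp [expandAff_mkAff, yAff]

theorem expandAff_algebraMap (h : Admissible R n q) (r : R) :
    expandAff z h (algebraMap R _ r) = HahnSeries.C r := by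
  simp [expandAff_mkAff, algebraMap_aff]

/-- Expansion of functions on `X°` into Laurent series at `D_∞`, with respect to the formal
parameter `t` along `D_∞` for which `x = t ^ (-q)` and `y = t ^ (-n) ∏ᵢ (1 - zᵢ t ^ q) ^ (1/q)`. -/
def expandInf (h : Admissible R n q) : OpenRing z q →+* R⸨X⸩ :=
  IsLocalization.Away.lift (g := expandAff z h) (yAff z q) (by
    rw [expandAff_y]
    exact isUnit_yExp z h)

theorem expandInf_algebraMap_aff (h : Admissible R n q) (f : AffRing z q) :
    expandInf z h (algebraMap _ _ f) = expandAff z h f :=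
  IsLocalization.Away.lift_eq _ _ _

theorem expandInf_x (h : Admissible R n q) : expandInf z h (xOpen z q) = xExp R q := by
  rw [xOpen, expandInf_algebraMap_aff, expandAff_x]

theorem expandInf_y (h : Admissible R n q) : expandInf z h (yOpen z q) = yExp z h := by
  rw [yOpen, expandInf_algebraMap_aff, expandAff_y]

theorem expandInf_algebraMap (h : Admissible R n q) (r : R) :
    expandInf z h (algebraMap R _ r) = HahnSeries.C r := by
  rw [IsScalarTower.algebraMap_apply R (AffRing z q), expandInf_algebraMap_aff,
    expandAff_algebraMap]

theorem expandInf_smul (h : Admissible R n q) (r : R) (f : OpenRing z q) :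
    expandInf z h (r • f) = r • expandInf z h f := by
  rw [Algebra.smul_def, map_mul, expandInf_algebraMap, HahnSeries.C_mul_eq_smul]

/-- Expansion of `1`-forms at `D_∞`: the form `f dg` has the expansion `F(t) dt / t` with
`F = f(t) · t g'(t)`. -/
def expandForm (h : Admissible R n q) : Ω[OpenRing z q⁄R] →ₗ[R] R⸨X⸩ :=
  letI : Module (OpenRing z q) R⸨X⸩ := Module.compHom _ (expandInf z h)
  haveI : IsScalarTower R (OpenRing z q) R⸨X⸩ := ⟨fun r f F => by
    change expandInf z h (r • f) * F = r • (expandInf z h f * F)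
    rw [expandInf_smul, ← HahnSeries.C_mul_eq_smul, ← HahnSeries.C_mul_eq_smul, mul_assoc]⟩
  (Derivation.liftKaehlerDifferential
    (Derivation.mk'
      { toFun := fun f => euler R (expandInf z h f)
        map_add' := fun f g => by simp
        map_smul' := fun r f => by simp [expandInf_smul] }
      (fun f g => by
        change euler R (expandInf z h (f * g)) =
          expandInf z h f * euler R (expandInf z h g) + expandInf z h g * euler R (expandInf z h f)
        rw [map_mul, euler_mul]) : Derivation R (OpenRing z q) R⸨X⸩)).restrictScalars R

theorem expandForm_smul_D (h : Admissible R n q) (f g : OpenRing z q) :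
    expandForm z h (f • KaehlerDifferential.D R _ g) =
      expandInf z h f * euler R (expandInf z h g) := by
  let _ : Module (OpenRing z q) R⸨X⸩ := Module.compHom _ (expandInf z h)
  have : IsScalarTower R (OpenRing z q) R⸨X⸩ := ⟨fun r f F => by
    change expandInf z h (r • f) * F = r • (expandInf z h f * F)
    rw [expandInf_smul, ← HahnSeries.C_mul_eq_smul, ← HahnSeries.C_mul_eq_smul, mul_assoc]⟩
  rw [expandForm, LinearMap.restrictScalars_apply, map_smul,
    Derivation.liftKaehlerDifferential_comp_D]
  rfl

/-- The residue at `D_∞` of a relative `1`-form on `X°`. -/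
def residueInf (h : Admissible R n q) : Ω[OpenRing z q⁄R] →ₗ[R] R where
  toFun ω := (expandForm z h ω).coeff 0
  map_add' ω η := by simp
  map_smul' r ω := by simp

theorem residueInf_smul_D (h : Admissible R n q) (f g : OpenRing z q) :
    residueInf z h (f • KaehlerDifferential.D R _ g) =
      (expandInf z h f * euler R (expandInf z h g)).coeff 0 := by
  rw [← expandForm_smul_D]
  rfl

/-- Series supported on exponents congruent to `c` modulo `q`. -/
def SupportedMod (q : ℕ) (c : ℤ) (F : R⸨X⸩) : Prop := ∀ m : ℤ, F.coeff m ≠ 0 → (q : ℤ) ∣ m - c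

theorem SupportedMod.mul {c d : ℤ} {F G : R⸨X⸩} (hF : SupportedMod q c F)
    (hG : SupportedMod q d G) : SupportedMod q (c + d) (F * G) := by
  intro m hm
  rw [HahnSeries.coeff_mul] at hm
  obtain ⟨ij, hij, hne⟩ := Finset.exists_ne_zero_of_sum_ne_zero hm
  rw [Finset.mem_antidiagonal] at hij
  have := dvd_add (hF _ hij.1) (hG _ hij.2.1)
  rwa [← hij.2.2, add_sub_add_comm]

theorem SupportedMod.pow {c : ℤ} {F : R⸨X⸩} (hF : SupportedMod q c F) (m : ℕ) :
    SupportedMod q (m * c) (F ^ m) := by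
  induction m with
  | zero =>
    intro k hk
    by_cases h : k = 0
    · simp [h]
    · exact absurd (by rw [pow_zero, HahnSeries.coeff_one, if_neg h]) hk
  | succ m ih =>
    rw [pow_succ]
    convert ih.mul hF using 1
    push_cast
    ring

theorem SupportedMod.euler {c : ℤ} {F : R⸨X⸩} (hF : SupportedMod q c F) :
    SupportedMod q c (euler R F) := fun m hm => hF m fun h0 => hm (by simp [euler_coeff, h0])

theorem supportedMod_xExp : SupportedMod q 0 (xExp R q) := by
  intro m hm
  by_cases h : m = -(q : ℤ)
  · simp [h]
  · exact absurd (HahnSeries.coeff_single_of_ne h) hm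

theorem supportedMod_yExp (h : Admissible R n q) : SupportedMod q (-(n : ℤ)) (yExp z h) := by
  rw [show (-(n : ℤ)) = -(n : ℤ) + 0 by simp]
  refine SupportedMod.mul ?_ ?_
  · intro m hm
    by_cases h : m = -(n : ℤ)
    · simp [h]
    · exact absurd (HahnSeries.coeff_single_of_ne h) hm
  · intro m hm
    rw [PowerSeries.coeff_coe] at hm
    split_ifs at hm with hneg
    · exact absurd rfl hm
    · by_contra hnd
      refine hm (PowerSeries.coeff_expand_of_not_dvd q h.pos.ne' _ fun hd => hnd ?_)
      rw [sub_zero]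
      exact Int.natCast_dvd.mpr hd

theorem SupportedMod.coeff_zero {c : ℤ} {F : R⸨X⸩} (hF : SupportedMod q c F)
    (hc : ¬ (q : ℤ) ∣ c) : F.coeff 0 = 0 := by
  by_contra h0
  exact hc (by simpa using hF 0 h0)

theorem coeff_zero_eval_mul_xExp (hq : 0 < q) (p : R[X]) :
    (eval₂ HahnSeries.C (xExp R q) p * xExp R q).coeff 0 = 0 := by
  induction p using Polynomial.induction_on' with
  | add p r hp hr => rw [eval₂_add, add_mul, HahnSeries.coeff_add, hp, hr, add_zero]
  | monomial m a =>
    rw [eval₂_monomial, mul_assoc, ← pow_succ, xExp, HahnSeries.single_pow,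
      HahnSeries.C_mul_eq_smul, HahnSeries.coeff_smul, HahnSeries.coeff_single_of_ne, smul_zero]
    simp only [nsmul_eq_mul, mul_neg, Nat.cast_succ]
    have : (0 : ℤ) < (m + 1) * q := by positivity
    omega

theorem yExp_pow_eq_eval (h : Admissible R n q) :
    yExp z h ^ q = eval₂ HahnSeries.C (xExp R q) (branchPoly z) := by
  rw [yExp_pow, branchPoly, eval₂_finsetProd]
  simp

theorem not_dvd_of_admissible (h : Admissible R n q) {b : ℕ} (hb : ¬ q ∣ b) :
    ¬ (q : ℤ) ∣ (b : ℤ) * -(n : ℤ) := by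
  rw [mul_neg, dvd_neg]
  intro hd
  exact hb (h.coprime.dvd_of_dvd_mul_right (by exact_mod_cast hd))

theorem coeff_zero_monomial (h : Admissible R n q) (a b : ℕ) :
    (xExp R q ^ (a + 1) * yExp z h ^ b).coeff 0 = 0 := by
  by_cases hb : q ∣ b
  · obtain ⟨c, rfl⟩ := hb
    rw [pow_mul, yExp_pow_eq_eval, ← eval₂_pow, pow_succ, mul_right_comm]
    have := coeff_zero_eval_mul_xExp h.pos (X ^ a * branchPoly z ^ c)
    rwa [eval₂_mul, eval₂_pow, eval₂_X] at this
  · have := ((supportedMod_xExp (R := R) (q := q)).pow (a + 1)).mul ((supportedMod_yExp z h).pow b)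
    refine this.coeff_zero ?_
    rw [mul_zero, zero_add]
    exact not_dvd_of_admissible h hb

theorem euler_xExp : euler R (xExp R q) = -((q : R⸨X⸩) * xExp R q) := by
  rw [xExp, euler_single, ← map_natCast (HahnSeries.C (Γ := ℤ) (R := R)) q,
    HahnSeries.C_mul_eq_smul]
  ext m
  by_cases h : m = -(q : ℤ)
  · simp [h]
  · simp [HahnSeries.coeff_single_of_ne h]

theorem euler_eval (p : R[X]) : euler R (eval₂ HahnSeries.C (xExp R q) p) =
    eval₂ HahnSeries.C (xExp R q) (derivative p) * euler R (xExp R q) := by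
  induction p using Polynomial.induction_on' with
  | add p r hp hr => rw [eval₂_add, map_add, hp, hr, derivative_add, eval₂_add, add_mul]
  | monomial m a =>
    rw [eval₂_monomial, euler_mul, euler_C, mul_zero, add_zero, euler_pow, derivative_monomial,
      eval₂_monomial, map_mul, map_natCast]
    ring

theorem coeff_zero_monomial_euler (h : Admissible R n q) (a b : ℕ) :
    (xExp R q ^ a * (yExp z h ^ b * euler R (yExp z h))).coeff 0 = 0 := by
  by_cases hb : q ∣ b + 1
  · obtain ⟨c, hc⟩ := hb
    obtain ⟨c, rfl⟩ : ∃ d, c = d + 1 := Nat.exists_eq_succ_of_ne_zero (by rintro rfl; simp at hc)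
    have hb : b = q * c + (q - 1) := by
      have := h.pos
      rw [mul_add, mul_one] at hc
      omega
    have h1 : (q : R⸨X⸩) * (yExp z h ^ (q - 1) * euler R (yExp z h)) =
        -((q : R⸨X⸩) * (eval₂ HahnSeries.C (xExp R q) (derivative (branchPoly z)) * xExp R q)) := by
      rw [← mul_assoc, ← euler_pow, yExp_pow_eq_eval, euler_eval, euler_xExp]
      ring
    have hu : IsUnit (q : R⸨X⸩) := by
      simpa using h.isUnit.map (HahnSeries.C (Γ := ℤ) (R := R))
    rw [← mul_neg] at h1
    have h2 := hu.mul_left_cancel h1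
    rw [hb, pow_add, mul_assoc, h2, pow_mul, yExp_pow_eq_eval]
    have := coeff_zero_eval_mul_xExp h.pos
      (X ^ a * (branchPoly z ^ c * derivative (branchPoly z)))
    rw [eval₂_mul, eval₂_mul, eval₂_pow, eval₂_X, eval₂_pow] at this
    rw [mul_neg, mul_neg, HahnSeries.coeff_neg, neg_eq_zero, ← this]
    congr 1
    ring
  · have := ((supportedMod_xExp (R := R) (q := q)).pow a).mul
      (((supportedMod_yExp z h).pow b).mul (supportedMod_yExp z h).euler)
    refine this.coeff_zero ?_
    have := not_dvd_of_admissible h hb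
    convert this using 2
    push_cast
    ring

theorem span_monomials_aff (f : AffRing z q) :
    f ∈ Submodule.span R {g | ∃ i s : ℕ, g = xAff z q ^ i * yAff z q ^ s} := by
  obtain ⟨p, rfl⟩ := mkAff_surjective z q f
  induction p using Polynomial.induction_on' with
  | add p r hp hr => rw [map_add]; exact Submodule.add_mem _ hp hr
  | monomial s p =>
    induction p using Polynomial.induction_on' with
    | add p r hp hr => rw [map_add, map_add]; exact Submodule.add_mem _ hp hr
    | monomial i a =>
      have : mkAff z q (monomial s (monomial i a)) = a • (xAff z q ^ i * yAff z q ^ s) := by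
        rw [← C_mul_X_pow_eq_monomial, ← C_mul_X_pow_eq_monomial, Algebra.smul_def,
          algebraMap_aff, xAff, yAff]
        simp only [map_mul, map_pow, mul_assoc]
      rw [this]
      exact Submodule.smul_mem _ _ (Submodule.subset_span ⟨i, s, rfl⟩)

/-- The residue theorem for regular forms on `W`. -/
theorem residueInf_resAff (h : Admissible R n q) (α : Ω[AffRing z q⁄R]) :
    residueInf z h (resAff z q α) = 0 := by
  have key : ∀ f g : AffRing z q, (expandAff z h f * euler R (expandAff z h g)).coeff 0 = 0 := by
    intro f g
    have smulE : ∀ (r : R) (u : AffRing z q), expandAff z h (r • u) = r • expandAff z h u := by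
      intro r u
      rw [Algebra.smul_def, map_mul, expandAff_algebraMap, HahnSeries.C_mul_eq_smul]
    have hf := span_monomials_aff z f
    induction hf using Submodule.span_induction with
    | zero => simp
    | add u v _ _ hu hv => rw [map_add, add_mul, HahnSeries.coeff_add, hu, hv, add_zero]
    | smul r u _ hu =>
      rw [smulE, ← HahnSeries.C_mul_eq_smul, mul_assoc, HahnSeries.C_mul_eq_smul,
        HahnSeries.coeff_smul, hu, smul_zero]
    | mem u hu =>
      obtain ⟨i, s, rfl⟩ := hu
      have hg := span_monomials_aff z g
      induction hg using Submodule.span_induction with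
      | zero => simp
      | add u v _ _ hu hv =>
        rw [map_add, map_add, mul_add, HahnSeries.coeff_add, hu, hv, add_zero]
      | smul r u _ hu =>
        rw [smulE, map_smul, ← HahnSeries.C_mul_eq_smul, mul_left_comm,
          HahnSeries.C_mul_eq_smul, HahnSeries.coeff_smul, hu, smul_zero]
      | mem u hu =>
        obtain ⟨k, l, rfl⟩ := hu
        rw [map_mul, map_mul, map_pow, map_pow, map_pow, map_pow, expandAff_x, expandAff_y,
          euler_mul, euler_pow, euler_pow, euler_xExp, mul_add, HahnSeries.coeff_add]
        have e1 : (xExp R q ^ i * yExp z h ^ s *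
            (xExp R q ^ k * ((l : R⸨X⸩) * yExp z h ^ (l - 1) * euler R (yExp z h)))).coeff 0
              = 0 := by
          have := coeff_zero_monomial_euler z h (i + k) (s + (l - 1))
          have e : xExp R q ^ i * yExp z h ^ s *
              (xExp R q ^ k * ((l : R⸨X⸩) * yExp z h ^ (l - 1) * euler R (yExp z h))) =
              l • (xExp R q ^ (i + k) * (yExp z h ^ (s + (l - 1)) * euler R (yExp z h))) := by
            rw [nsmul_eq_mul]; ring
          rw [e, HahnSeries.coeff_nsmul, Pi.smul_apply, this, smul_zero]
        have e2 : (xExp R q ^ i * yExp z h ^ s * (yExp z h ^ l *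
            ((k : R⸨X⸩) * xExp R q ^ (k - 1) * -((q : R⸨X⸩) * xExp R q)))).coeff 0 = 0 := by
          have := coeff_zero_monomial z h (i + (k - 1)) (s + l)
          have e : xExp R q ^ i * yExp z h ^ s * (yExp z h ^ l *
              ((k : R⸨X⸩) * xExp R q ^ (k - 1) * -((q : R⸨X⸩) * xExp R q))) =
              -((k * q : ℕ) • (xExp R q ^ (i + (k - 1) + 1) * yExp z h ^ (s + l))) := by
            rw [nsmul_eq_mul]; push_cast; ring
          rw [e, HahnSeries.coeff_neg, HahnSeries.coeff_nsmul, Pi.smul_apply, this, smul_zero,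
            neg_zero]
        rw [e1, e2, add_zero]
  have hα : α ∈ Submodule.span (AffRing z q)
      (Set.range (KaehlerDifferential.D R (AffRing z q))) := by
    rw [KaehlerDifferential.span_range_derivation]
    trivial
  induction hα using Submodule.span_induction with
  | zero => simp
  | add u v _ _ hu hv => rw [map_add, map_add, hu, hv, add_zero]
  | mem u hu =>
    obtain ⟨g, rfl⟩ := hu
    have := residueInf_smul_D z h 1 (algebraMap _ (OpenRing z q) g)
    rw [one_smul] at this
    rw [resAff_D, this, expandInf_algebraMap_aff, map_one, ← map_one (expandAff z h), key]
  | smul f u hu0 hu =>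
    clear hu
    induction hu0 using Submodule.span_induction generalizing f with
    | zero => simp
    | add u v _ _ hu hv => rw [smul_add, map_add, map_add, hu, hv, add_zero]
    | smul f' u _ hu => rw [smul_smul]; exact hu _
    | mem u hu =>
      obtain ⟨g, rfl⟩ := hu
      have e : resAff z q (f • KaehlerDifferential.D R (AffRing z q) g) =
          algebraMap _ (OpenRing z q) f • KaehlerDifferential.D R (OpenRing z q)
            (algebraMap _ (OpenRing z q) g) := by
        rw [resAff, LinearMap.restrictScalars_apply, map_smul, KaehlerDifferential.map_D,
          algebraMap_smul]
      rw [e, residueInf_smul_D, expandInf_algebraMap_aff, expandInf_algebraMap_aff, key]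

theorem residueInf_D (h : Admissible R n q) (f : OpenRing z q) :
    residueInf z h (KaehlerDifferential.D R _ f) = 0 := by
  have := residueInf_smul_D z h 1 f
  rw [one_smul] at this
  rw [this, map_one, one_mul, euler_coeff]
  simp

theorem expandInf_yInv (h : Admissible R n q) : ∃ p : PowerSeries R,
    expandInf z h (yInv z q) = HahnSeries.single (n : ℤ) 1 * HahnSeries.ofPowerSeries ℤ R p := by
  obtain ⟨p, hp⟩ := (isUnit_rootExp z h).exists_right_inv
  refine ⟨p, (isUnit_yExp z h).mul_left_cancel ?_⟩
  rw [← expandInf_y, ← map_mul, yOpen_mul_yInv, map_one, expandInf_y, yExp, mul_mul_mul_comm,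
    ← map_mul, hp, HahnSeries.single_mul_single]
  simp

theorem exists_powerSeries_of_mem (h : Admissible R n q) {f : OpenRing z q}
    (hf : f ∈ InfRing z q) :
    ∃ p : PowerSeries R, expandInf z h f = HahnSeries.ofPowerSeries ℤ R p := by
  induction hf using Algebra.adjoin_induction with
  | mem f hf =>
    obtain ⟨i, m, him, rfl⟩ := hf
    obtain ⟨p, hp⟩ := expandInf_yInv z h
    obtain ⟨d, hd⟩ := Nat.exists_eq_add_of_le him
    refine ⟨PowerSeries.X ^ d * p ^ m, ?_⟩
    rw [map_mul, map_pow, map_pow, hp, expandInf_x, mul_pow, xExp, HahnSeries.single_pow,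
      HahnSeries.single_pow, ← mul_assoc, HahnSeries.single_mul_single,
      map_mul (HahnSeries.ofPowerSeries ℤ R), map_pow (HahnSeries.ofPowerSeries ℤ R),
      map_pow (HahnSeries.ofPowerSeries ℤ R), HahnSeries.ofPowerSeries_X, HahnSeries.single_pow]
    congr 2
    · simp only [nsmul_eq_mul]
      have : (n : ℤ) * m = q * i + d := by exact_mod_cast hd
      congr 1
      · linarith
    · simp
  | algebraMap r =>
    exact ⟨PowerSeries.C r, by rw [expandInf_algebraMap, HahnSeries.ofPowerSeries_C]⟩
  | add f g _ _ hf hg =>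
    obtain ⟨p, hp⟩ := hf
    obtain ⟨s, hs⟩ := hg
    exact ⟨p + s, by rw [map_add, map_add, hp, hs]⟩
  | mul f g _ _ hf hg =>
    obtain ⟨p, hp⟩ := hf
    obtain ⟨s, hs⟩ := hg
    exact ⟨p * s, by rw [map_mul, map_mul, hp, hs]⟩

theorem nonneg_of_mem_support (p : PowerSeries R) {m : ℤ}
    (hm : m ∈ (HahnSeries.ofPowerSeries ℤ R p).support) : 0 ≤ m := by
  by_contra hneg
  refine hm ?_
  rw [PowerSeries.coeff_coe, if_pos (not_le.mp hneg)]

/-- A form on `V` is regular at `D_∞` and has residue zero there. -/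
theorem residueInf_smul_resInf (h : Admissible R n q) (f : InfRing z q) (β : Ω[InfRing z q⁄R]) :
    residueInf z h ((f : OpenRing z q) • resInf z q β) = 0 := by
  have key : ∀ f g : InfRing z q,
      (expandInf z h f * euler R (expandInf z h g)).coeff 0 = 0 := by
    intro f g
    obtain ⟨p, hp⟩ := exists_powerSeries_of_mem z h f.2
    obtain ⟨s, hs⟩ := exists_powerSeries_of_mem z h g.2
    rw [hp, hs, HahnSeries.coeff_mul]
    refine Finset.sum_eq_zero fun ij hij => ?_
    rw [Finset.mem_antidiagonal] at hij
    have h1 := nonneg_of_mem_support p hij.1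
    have h2 := nonneg_of_mem_support s (euler_support _ hij.2.1)
    have h3 : ij.2 = 0 := by
      have := hij.2.2
      omega
    rw [h3, euler_coeff]
    simp
  have hβ : β ∈ Submodule.span (InfRing z q)
      (Set.range (KaehlerDifferential.D R (InfRing z q))) := by
    rw [KaehlerDifferential.span_range_derivation]
    trivial
  have smulE : ∀ (f : InfRing z q) (u : Ω[InfRing z q⁄R]),
      resInf z q (f • u) = (f : OpenRing z q) • resInf z q u := by
    intro f u
    rw [resInf, LinearMap.restrictScalars_apply, map_smul]
    rfl
  induction hβ using Submodule.span_induction generalizing f with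
  | zero => simp
  | add u v _ _ hu hv => rw [map_add, smul_add, map_add, hu, hv, add_zero]
  | smul f' u _ hu =>
    rw [smulE, smul_smul]
    exact hu (f * f')
  | mem u hu =>
    obtain ⟨g, rfl⟩ := hu
    rw [resInf_D, residueInf_smul_D, key]

/-! ### The Poincaré pairing -/

theorem smul_resAff (f : AffRing z q) (α : Ω[AffRing z q⁄R]) :
    algebraMap (AffRing z q) (OpenRing z q) f • resAff z q α = resAff z q (f • α) := by
  rw [resAff, LinearMap.restrictScalars_apply, LinearMap.restrictScalars_apply, map_smul,
    algebraMap_smul]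

/-- The cup product of `1`-cochains `(α₁, β₁, γ₁)` and `(α₂, β₂, γ₂)`, as a `1`-form on
`X° = W ∩ V`: the form `γ₁ β₂ - γ₂ α₁`. -/
def cup : Cochain z q →ₗ[R] Cochain z q →ₗ[R] Ω[OpenRing z q⁄R] :=
  LinearMap.mk₂ R (fun a b => a.2.2 • resInf z q b.2.1 - b.2.2 • resAff z q a.1)
    (fun a a' b => by
      simp only [Prod.snd_add, Prod.fst_add, map_add, add_smul, smul_add]; abel)
    (fun r a b => by
      simp only [Prod.smul_snd, Prod.smul_fst, map_smul, smul_sub, smul_assoc,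
        smul_comm r b.2.2])
    (fun a b b' => by
      simp only [Prod.snd_add, Prod.fst_add, map_add, add_smul, smul_add]; abel)
    (fun r a b => by
      simp only [Prod.smul_snd, Prod.smul_fst, map_smul, smul_sub, smul_assoc,
        smul_comm r a.2.2])

/-- The cup product of cocycles, followed by the trace map `H²_dR(X/S) → 𝒪(S)`. A class in
`H²_dR(X/S)` is represented by a form on `X° = W ∩ V`, and its trace is the sum of the residues of
that form at the points outside `W`, that is, the residue at `D_∞`. -/
def cupTrace (h : Admissible R n q) : Cocycle z q →ₗ[R] Cocycle z q →ₗ[R] R :=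
  ((cup z).compr₂ (residueInf z h)).domRestrict₁₂ (Cocycle z q) (Cocycle z q)

theorem cupTrace_apply (h : Admissible R n q) (a b : Cocycle z q) : cupTrace z h a b =
    residueInf z h ((a : Cochain z q).2.2 • resInf z q (b : Cochain z q).2.1 -
      (b : Cochain z q).2.2 • resAff z q (a : Cochain z q).1) := rfl

theorem cocycle_eq (a : Cocycle z q) : KaehlerDifferential.D R (OpenRing z q) (a : Cochain z q).2.2
    = resAff z q (a : Cochain z q).1 - resInf z q (a : Cochain z q).2.1 := by
  have h : cochainDiff z q (a : Cochain z q) = 0 := a.2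
  rw [cochainDiff_apply, sub_eq_zero] at h
  exact h.symm

theorem residueInf_smul_D_comm (h : Admissible R n q) (f g : OpenRing z q) :
    residueInf z h (f • KaehlerDifferential.D R _ g) =
      -residueInf z h (g • KaehlerDifferential.D R _ f) := by
  rw [eq_neg_iff_add_eq_zero, ← map_add, ← Derivation.leibniz, residueInf_D]

theorem residueInf_cup_left (h : Admissible R n q) (f : AffRing z q) (g : InfRing z q)
    (b : Cocycle z q) :
    residueInf z h ((algebraMap (AffRing z q) (OpenRing z q) f - (g : OpenRing z q)) •
      resInf z q (b : Cochain z q).2.1 - (b : Cochain z q).2.2 •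
        KaehlerDifferential.D R _ (algebraMap (AffRing z q) (OpenRing z q) f)) = 0 := by
  have hb : resInf z q (b : Cochain z q).2.1 = resAff z q (b : Cochain z q).1 -
      KaehlerDifferential.D R (OpenRing z q) (b : Cochain z q).2.2 := by
    rw [cocycle_eq]; abel
  rw [map_sub, sub_smul, map_sub, residueInf_smul_resInf, sub_zero, residueInf_smul_D_comm, hb,
    smul_sub, map_sub, smul_resAff, residueInf_resAff]
  ring

theorem residueInf_cup_right (h : Admissible R n q) (f : AffRing z q) (g : InfRing z q)
    (a : Cocycle z q) :
    residueInf z h ((a : Cochain z q).2.2 • KaehlerDifferential.D R _ (g : OpenRing z q) -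
      (algebraMap (AffRing z q) (OpenRing z q) f - (g : OpenRing z q)) •
        resAff z q (a : Cochain z q).1) = 0 := by
  have ha : (g : OpenRing z q) • resAff z q (a : Cochain z q).1 =
      (g : OpenRing z q) • resInf z q (a : Cochain z q).2.1 + (g : OpenRing z q) •
        KaehlerDifferential.D R (OpenRing z q) (a : Cochain z q).2.2 := by
    rw [cocycle_eq, ← smul_add]; congr 1; abel
  rw [map_sub, sub_smul, map_sub, smul_resAff, residueInf_resAff, ha, map_add,
    residueInf_smul_resInf, residueInf_smul_D_comm]
  ring

theorem cupTrace_left (h : Admissible R n q) (a b : Cocycle z q)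
    (ha : a ∈ Coboundary z q) :
    cupTrace z h a b = 0 := by
  obtain ⟨f, g, hfg⟩ := (mem_coboundary z q a).1 ha
  rw [cupTrace_apply, hfg]
  dsimp only
  rw [resAff_D, residueInf_cup_left]

theorem cupTrace_right (h : Admissible R n q) (a b : Cocycle z q)
    (hb : b ∈ Coboundary z q) :
    cupTrace z h a b = 0 := by
  obtain ⟨f, g, hfg⟩ := (mem_coboundary z q b).1 hb
  rw [cupTrace_apply, hfg]
  dsimp only
  rw [resInf_D, residueInf_cup_right]

/-- The Poincaré pairing `H¹_dR(X/S) × H¹_dR(X/S) → H²_dR(X/S) → 𝒪(S)`, where the trace map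
`H²_dR(X/S) → 𝒪(S)` is the sum of residues on the fibres of `X/S`. -/
def poincare (h : Admissible R n q) : H1dR z q →ₗ[R] H1dR z q →ₗ[R] R :=
  Submodule.liftQ _
    (LinearMap.flip (Submodule.liftQ _ (LinearMap.flip (cupTrace z h)) (by
      intro b hb
      rw [LinearMap.mem_ker]
      ext a
      exact cupTrace_right z h a b hb)))
    (by
      intro a ha
      rw [LinearMap.mem_ker]
      ext b
      exact cupTrace_left z h a b ha)

theorem poincare_mk (h : Admissible R n q) (a b : Cocycle z q) :
    poincare z h (Submodule.Quotient.mk a) (Submodule.Quotient.mk b) =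
      residueInf z h ((a : Cochain z q).2.2 • resInf z q (b : Cochain z q).2.1 -
        (b : Cochain z q).2.2 • resAff z q (a : Cochain z q).1) := rfl

/-- The Poincaré pairing normalized by the trace of the projective line: it is computed like
`poincare`, but with the trace map `H²_dR(X/S) → 𝒪(S)` for which the composite
`H²_dR(ℙ¹_S/S) → H²_dR(X/S) → 𝒪(S)` with the pull-back along the degree `q` map `x : X → ℙ¹_S` is
the trace map of `ℙ¹_S`. That map is `1 / q` times the sum of residues on `X`, because the residue
at `D_∞` of the pull-back of a form on `ℙ¹_S` is `q` times its residue at infinity. -/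
def poincareP1 (h : Admissible R n q) : H1dR z q →ₗ[R] H1dR z q →ₗ[R] R :=
  ((h.isUnit.unit⁻¹ : Rˣ) : R) • poincare z h

end Charts

/-! ### The universal base -/

/-- The integer `N = ∏ (q a - n r)`, the product over the integers `a` with `0 ≤ a ≤ r n / q`. -/
def basisFactor (n q r : ℕ) : ℤ :=
  ∏ a ∈ Finset.range (r * n / q + 1), ((q : ℤ) * a - (n : ℤ) * r)

/-- The polynomial `n q N ∏_{i < j} (zᵢ - z_j)`. Inverting it in `ℤ[z₁, …, zₙ]` gives the ring of
functions on `S × Spec ℤ[1/N]`, with `S = Spec ℤ[1/(nq)][z₁, …, zₙ, (zᵢ - z_j)⁻¹]`. -/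
def baseElement (n q r : ℕ) : MvPolynomial (Fin n) ℤ :=
  MvPolynomial.C ((n : ℤ) * q * basisFactor n q r) *
    ∏ i, ∏ j ∈ Finset.Ioi i, (MvPolynomial.X i - MvPolynomial.X j)

/-- The coordinate functions `z₁, …, zₙ` on the base. -/
def coord (n : ℕ) (R : Type*) [CommRing R] [Algebra (MvPolynomial (Fin n) ℤ) R] : Fin n → R :=
  fun i => algebraMap (MvPolynomial (Fin n) ℤ) R (MvPolynomial.X i)

/-- The function `C_k(z) = ∏_{i ≠ k} (z_k - zᵢ)`. -/
def branchDiff {n : ℕ} (z : Fin n → R) (k : Fin n) : R :=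
  ∏ i ∈ Finset.univ.erase k, (z k - z i)

theorem admissible_of_base {n q r : ℕ} (hq : 0 < q) (hqn : Nat.Coprime q n)
    (R : Type*) [CommRing R] [Algebra (MvPolynomial (Fin n) ℤ) R]
    [IsLocalization.Away (baseElement n q r) R] : Admissible R n q := by
  refine ⟨hq, hqn, ?_⟩
  have h : IsUnit (algebraMap (MvPolynomial (Fin n) ℤ) R (baseElement n q r)) :=
    IsLocalization.Away.algebraMap_isUnit (baseElement n q r)
  have hd : ((q : ℕ) : MvPolynomial (Fin n) ℤ) ∣ baseElement n q r := by
    refine Dvd.dvd.mul_right ⟨MvPolynomial.C ((n : ℤ) * basisFactor n q r), ?_⟩ _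
    rw [← map_natCast MvPolynomial.C, ← map_mul]
    congr 1
    ring
  have := isUnit_of_dvd_unit (map_dvd (algebraMap (MvPolynomial (Fin n) ℤ) R) hd) h
  simpa using this

end CyclicCurve

end

noncomputable section

open Polynomial LaurentSeries
open scoped KaehlerDifferential

namespace CyclicCurve

variable {R : Type*} [CommRing R] {n : ℕ} (z : Fin n → R) (q : ℕ)

/-! ### Differentials of the functions `A(x) y ^ (-m)` -/

/-! Put `G = P / (x - z_k)`, so that `1 / (x - z_k) = G y^(-q)` and `G(z_k) = C_k`. The form `ω = dx
/ (y^r (x - z_k)) = G y^(-r-q) dx` is regular at infinity but not at the finite branch points. There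
it is corrected by an exact form: for `γ = (q / (r C_k)) G y^(-r)` the polynomial numerator of `ω +
dγ` over `y^(r+q)` is divisible by `P = y^q`, which leaves `B(x) dx / y^r` with `B` a polynomial. As
`r < q`, this is regular on `W`. Hence `(ω + dγ, ω, γ)` is a cocycle whose class restricts to that
of `ω` (`exists_class_omegaForm`).

The class of the global form `μ` is `(μ, μ, 0)`, so the cup product is `γ μ`. The powers of `y`
combine: `γ μ = (q / (r C_k)) x^(j-1) dx / (x - z_k)`. This is pulled back from the line, and `x` is
totally ramified of degree `q` at infinity, so its residue there is `-q z_k^(j-1)` times the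
constant (`residueInf_smul_muForm`). The pairing is therefore `-q^2 z_k^(j-1) / (r C_k)`; the
normalization by the line divides by `q`.

It remains to see that every other class with the same rational restriction gives the same value
(`poincare_eq_of_restrictsTo`). Suppose `(α, β, γ)` has `α = df` on `X°`. In a domain of
characteristic zero a Laurent series whose derivative has no pole has none itself. So `f` has no
pole along the `D_k` and is a function on `W`, and `γ - f`, whose differential is `-β`, has no pole
at infinity. Then `γ μ = f μ + (γ - f) μ` has residue zero: the first term by the residue theorem on
`W`, the second because it is regular at infinity (`poincare_eq_zero_of_restrictOpen`).

The technical cost lies in regularity of forms, which here means lying in the image of the Kähler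
differentials of the chart rings: `yInv_pow_mul_aeval_smul_mem_range_resAff` on `W` and
`yInv_pow_mul_xOpen_pow_smul_mem` on `V`. -/

theorem aeval_xAff_branchPoly : aeval (xAff z q) (branchPoly z) = yAff z q ^ q := by
  rw [yAff_pow, branchPoly, map_prod]
  simp

theorem algebraMap_aeval_xAff (A : R[X]) :
    algebraMap (AffRing z q) (OpenRing z q) (aeval (xAff z q) A) = aeval (xOpen z q) A := by
  rw [xOpen, aeval_algebraMap_apply]

theorem aeval_xOpen_branchPoly : aeval (xOpen z q) (branchPoly z) = yOpen z q ^ q := by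
  rw [← algebraMap_aeval_xAff, aeval_xAff_branchPoly, map_pow, yOpen]

theorem yOpen_pow_mul_yInv_pow (m : ℕ) : yOpen z q ^ m * yInv z q ^ m = 1 := by
  rw [← mul_pow, yOpen_mul_yInv, one_pow]

theorem aeval_branchPoly_mul_yInv_pow (m : ℕ) :
    aeval (xOpen z q) (branchPoly z) * yInv z q ^ (m + q) = yInv z q ^ m := by
  rw [aeval_xOpen_branchPoly, pow_add, mul_left_comm, yOpen_pow_mul_yInv_pow, mul_one]

theorem aeval_branchPoly_pow_mul_yInv_pow (m k : ℕ) :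
    aeval (xOpen z q) (branchPoly z) ^ k * yInv z q ^ (m + q * k) = yInv z q ^ m := by
  rw [aeval_xOpen_branchPoly, pow_add, ← pow_mul, mul_left_comm, yOpen_pow_mul_yInv_pow, mul_one]

theorem smul_pow_D_yOpen : ((q : OpenRing z q) * yOpen z q ^ (q - 1)) •
      KaehlerDifferential.D R _ (yOpen z q) =
    aeval (xOpen z q) (derivative (branchPoly z)) • KaehlerDifferential.D R _ (xOpen z q) := by
  rw [← Derivation.map_aeval, aeval_xOpen_branchPoly, Derivation.leibniz_pow, mul_smul,
    Nat.cast_smul_eq_nsmul]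

variable {q}

/-- The chain rule combined with `q y^(q-1) dy = P'(x) dx`. The factor `q` stays on the left to
avoid dividing by it. -/
theorem smul_D_yInv_pow (hq : 0 < q) (m : ℕ) :
    (q : OpenRing z q) • KaehlerDifferential.D R _ (yInv z q ^ m) =
      (-(m * aeval (xOpen z q) (derivative (branchPoly z)) * yInv z q ^ (m + q))) •
        KaehlerDifferential.D R _ (xOpen z q) := by
  have hy := yOpen_pow_mul_yInv_pow z q (q - 1)
  have hD := Derivation.leibniz_of_mul_eq_one (KaehlerDifferential.D R (OpenRing z q))
    ((mul_comm _ _).trans (yOpen_mul_yInv z q))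
  cases m with
  | zero => simp
  | succ m =>
    obtain ⟨p, rfl⟩ : ∃ p, q = p + 1 := ⟨q - 1, by omega⟩
    rw [Nat.add_sub_cancel] at hy
    rw [Derivation.leibniz_pow, hD, ← Nat.cast_smul_eq_nsmul (OpenRing z (p + 1)), smul_smul,
      smul_smul, smul_smul, Nat.add_sub_cancel]
    -- Inserts `1 = y^p y^(-p)` so that the factor `q y^(q-1)` in front of `dy` becomes visible and
    -- can be traded for `P'(x)`.
    have e : ∀ u v w : OpenRing z (p + 1), (u * (v * (yInv z (p + 1) ^ m * w))) =
        (v * yInv z (p + 1) ^ (m + p) * w) * (u * yOpen z (p + 1) ^ p) := by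
      intro u v w
      calc _ = u * (v * (yInv z (p + 1) ^ m * w)) * 1 := by ring
        _ = _ := by rw [← hy]; ring
    rw [show ((p + 1 : ℕ) : OpenRing z (p + 1)) * ((m + 1 : ℕ) : OpenRing z (p + 1)) *
        yInv z (p + 1) ^ m * -yInv z (p + 1) ^ 2 = (p + 1 : ℕ) * ((m + 1 : ℕ) *
        (yInv z (p + 1) ^ m * -yInv z (p + 1) ^ 2)) by ring, e, mul_smul]
    have := smul_pow_D_yOpen z (p + 1)
    rw [Nat.add_sub_cancel] at this
    rw [this, smul_smul]
    congr 1
    ring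

/-- The common denominator `y^(m+q)` comes from writing `y^(-m) = P(x) y^(-m-q)`. Exact forms
thereby become polynomials in `x`, and questions of regularity become questions of degree or of
divisibility by `P`. -/
theorem smul_D_aeval_mul_yInv_pow (hq : 0 < q) (A : R[X]) (m : ℕ) :
    (q : OpenRing z q) • KaehlerDifferential.D R _ (aeval (xOpen z q) A * yInv z q ^ m) =
      (yInv z q ^ (m + q) * aeval (xOpen z q)
        ((q : R[X]) * derivative A * branchPoly z - (m : R[X]) * A * derivative (branchPoly z))) •
        KaehlerDifferential.D R _ (xOpen z q) := by
  rw [Derivation.leibniz, smul_add, smul_comm, smul_D_yInv_pow z hq, Derivation.map_aeval,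
    smul_smul, smul_smul, smul_smul, ← add_smul]
  congr 1
  simp only [map_sub, map_mul, map_natCast, mul_sub]
  rw [← aeval_branchPoly_mul_yInv_pow z q m]
  ring

/-! ### Regularity along the point at infinity -/

theorem smul_D_mem_range_resInf {f g : OpenRing z q} (hf : f ∈ InfRing z q)
    (hg : g ∈ InfRing z q) :
    f • KaehlerDifferential.D R _ g ∈ LinearMap.range (resInf z q) := by
  refine ⟨(⟨f, hf⟩ : InfRing z q) • KaehlerDifferential.D R _ ⟨g, hg⟩, ?_⟩
  rw [resInf, LinearMap.restrictScalars_apply, map_smul, KaehlerDifferential.map_D]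
  rfl

theorem yInv_pow_mul_xOpen_pow_mem {a m : ℕ} (h : q * a ≤ n * m) :
    yInv z q ^ m * xOpen z q ^ a ∈ InfRing z q :=
  Algebra.subset_adjoin ⟨a, m, h, mul_comm _ _⟩

theorem yInv_pow_mul_aeval_mem (A : R[X]) {m : ℕ} (h : q * A.natDegree ≤ n * m) :
    yInv z q ^ m * aeval (xOpen z q) A ∈ InfRing z q := by
  rw [aeval_eq_sum_range, Finset.mul_sum]
  refine Subalgebra.sum_mem _ fun a ha => ?_
  rw [mul_smul_comm]
  refine Subalgebra.smul_mem _ (yInv_pow_mul_xOpen_pow_mem z (le_trans ?_ h)) _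
  exact Nat.mul_le_mul_left _ (Nat.lt_succ_iff.1 (Finset.mem_range.1 ha))

/-- Linearity in the numerator. Hypotheses are asked only for exponents in the support, so that
cancellation of leading terms can be exploited. -/
theorem yInv_pow_mul_aeval_smul_mem_of_forall {M : Submodule R (Ω[OpenRing z q⁄R])} (A : R[X])
    (m : ℕ) (h : ∀ a ∈ A.support,
      (yInv z q ^ m * xOpen z q ^ a) • KaehlerDifferential.D R _ (xOpen z q) ∈ M) :
    (yInv z q ^ m * aeval (xOpen z q) A) • KaehlerDifferential.D R _ (xOpen z q) ∈ M := by
  rw [aeval_def, eval₂_eq_sum, sum_def, Finset.mul_sum, Finset.sum_smul]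
  refine Submodule.sum_mem _ fun a ha => ?_
  rw [← Algebra.smul_def, mul_smul_comm, smul_assoc]
  exact Submodule.smul_mem _ _ (h a ha)

theorem monic_branchPoly : (branchPoly z).Monic := monic_prod_X_sub_C _ _

theorem natDegree_branchPoly_le : (branchPoly z).natDegree ≤ n := by
  refine (natDegree_prod_le _ _).trans ?_
  refine (Finset.sum_le_sum fun i _ => natDegree_X_sub_C_le (z i)).trans ?_
  simp

theorem coeff_branchPoly : (branchPoly z).coeff n = 1 := by
  nontriviality R
  have := monic_branchPoly z
  rwa [Monic, leadingCoeff, branchPoly, natDegree_finsetProd_X_sub_C_eq_card,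
    Finset.card_univ, Fintype.card_fin] at this

/-- Up to forms of smaller degree, `x ^ a dx` times `P(x) ^ (l + 1)` is, for `n s - q i = 1`, a
multiple of the logarithmic derivative of the local parameter `x ^ i y ^ (-s)` at infinity. -/
theorem exists_lower_degree {i s a l c : ℕ} (hn : 0 < n) (hi : 0 < i) (his : n * s = q * i + 1)
    (hc : c + i = a + 1 + n * l) :
    ∀ e, a + n * (l + 1) ≤ e → (X ^ a * branchPoly z ^ (l + 1) + X ^ c *
      ((q : R[X]) * derivative (X ^ i) * branchPoly z -
        (s : R[X]) * X ^ i * derivative (branchPoly z))).coeff e = 0 := by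
  intro e he
  have hP := natDegree_branchPoly_le z
  have hP1 := coeff_branchPoly z
  set P := branchPoly z
  have hXP : (X * derivative P).natDegree ≤ n := by
    refine natDegree_le_iff_coeff_eq_zero.2 fun N hN => ?_
    obtain ⟨N, rfl⟩ : ∃ k, N = k + 1 := ⟨N - 1, by omega⟩
    rw [coeff_X_mul, coeff_derivative, coeff_eq_zero_of_natDegree_lt (by omega), zero_mul]
  have hXP1 : (X * derivative P).coeff n = (n : R) := by
    obtain ⟨m, hm⟩ : ∃ k, n = k + 1 := ⟨n - 1, by omega⟩
    rw [hm, coeff_X_mul, coeff_derivative, ← hm, hP1, hm]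
    push_cast; ring
  obtain ⟨i, rfl⟩ : ∃ k, i = k + 1 := ⟨i - 1, by omega⟩
  -- `X ^ c` times the bracket is `X ^ (a + n * l) * Q`. The coefficient of `Q` in degree `n` is `q
  -- i - s n = -1`, which cancels the leading coefficient `1` of `X ^ a * P ^ (l + 1)`.
  set Q : R[X] := (q * (i + 1) : ℕ) • P - s • (X * derivative P) with hQ
  have hQd : Q.natDegree ≤ n :=
    (natDegree_sub_le _ _).trans (max_le ((natDegree_smul_le _ _).trans hP)
      ((natDegree_smul_le _ _).trans hXP))
  have hQ1 : Q.coeff n = -1 := by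
    rw [hQ, coeff_sub, coeff_smul, coeff_smul, hP1, hXP1, nsmul_eq_mul, nsmul_eq_mul]
    have : (n : R) * s = q * (i + 1) + 1 := by exact_mod_cast congrArg (Nat.cast (R := R)) his
    push_cast
    linear_combination -this
  have e1 : X ^ c * ((q : R[X]) * derivative (X ^ (i + 1)) * P -
      (s : R[X]) * X ^ (i + 1) * derivative P) = Q * X ^ (a + n * l) := by
    rw [hQ, show a + n * l = c + i by omega]
    simp only [nsmul_eq_mul, derivative_X_pow, Nat.add_sub_cancel, map_natCast]
    push_cast
    ring
  rw [e1, pow_succ, coeff_add]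
  have hPl : (X ^ a * P ^ l).natDegree ≤ a + n * l := by
    refine natDegree_mul_le.trans (add_le_add (natDegree_X_pow_le _) ?_)
    exact natDegree_pow_le.trans (by rw [mul_comm]; exact Nat.mul_le_mul_right _ hP)
  have hPl1 : (X ^ a * P ^ l).coeff (a + n * l) = 1 := by
    rw [coeff_X_pow_mul', if_pos (by omega), Nat.add_sub_cancel_left, mul_comm,
      coeff_pow_of_natDegree_le hP, hP1, one_pow]
  rcases he.eq_or_lt with rfl | he
  · rw [show a + n * (l + 1) = (a + n * l) + n by ring, ← mul_assoc,
      coeff_mul_add_eq_of_natDegree_le hPl hP, hPl1, hP1, mul_one, add_comm (a + n * l) n,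
      coeff_mul_X_pow, hQ1]
    ring
  · rw [mul_add, mul_one] at he
    rw [← mul_assoc, coeff_eq_zero_of_natDegree_lt, coeff_eq_zero_of_natDegree_lt, add_zero]
    · refine lt_of_le_of_lt (natDegree_mul_le.trans
        (add_le_add hQd (natDegree_X_pow_le _))) ?_
      omega
    · exact lt_of_le_of_lt (natDegree_mul_le.trans (add_le_add hPl hP)) (by omega)

/-- Take `s` inverse to `n` modulo `q`. Since `x` and `y` have poles of order `q` and `n` at
infinity, `x^i y^(-s)` vanishes there to order `n s - q i = 1`. -/
theorem exists_local_parameter (hq : 1 < q) (hn : 1 < n) (hqn : Nat.Coprime q n) :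
    ∃ i s : ℕ, 0 < i ∧ n * s = q * i + 1 := by
  obtain ⟨s, -, hs⟩ := Nat.exists_mul_mod_eq_one_of_coprime hqn.symm hq
  refine ⟨n * s / q, s, Nat.pos_of_ne_zero fun h0 => ?_, ?_⟩
  · have := Nat.div_add_mod (n * s) q
    rw [h0, hs] at this
    have := Nat.eq_one_of_mul_eq_one_right (show n * s = 1 by omega)
    omega
  · rw [← hs, Nat.div_add_mod]

/-- The form vanishes at infinity to order `n m - q (a + 1) - 1 ≥ 0`. Subtracting a suitable
multiple of `f dt`, with `t` the local parameter and `f` a monomial regular at infinity, raises this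
order. Once it is large, the form is visibly a combination of differentials of functions on `V`. -/
theorem yInv_pow_mul_xOpen_pow_smul_mem (hq : 1 < q) (hn : 1 < n) (hqn : Nat.Coprime q n)
    (a m : ℕ) (h : q * (a + 1) < n * m) :
    (yInv z q ^ m * xOpen z q ^ a) • KaehlerDifferential.D R _ (xOpen z q) ∈
      LinearMap.range (resInf z q) := by
  obtain ⟨i, s, hi, his⟩ := exists_local_parameter hq hn hqn
  -- Induction on a bound `e` for the amount by which `n m - q (a + 1)` falls short of `2 n q`.
  suffices H : ∀ e a m : ℕ, q * (a + 1) < n * m → q * (a + 1) + 2 * (n * q) ≤ n * m + e →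
      (yInv z q ^ m * xOpen z q ^ a) • KaehlerDifferential.D R _ (xOpen z q) ∈
        LinearMap.range (resInf z q) from
    H (q * (a + 1) + 2 * (n * q)) a m h (Nat.le_add_left _ _)
  clear h a m
  intro e
  induction e with
  | zero =>
    intro a m _ h
    obtain ⟨m, rfl⟩ : ∃ k, m = k + q + q := by
      have : 2 * q ≤ m := by
        by_contra! hlt
        have : n * m < n * (2 * q) := Nat.mul_lt_mul_of_pos_left hlt (by omega)
        nlinarith
      exact ⟨m - 2 * q, by omega⟩
    have h1 : yInv z q ^ m * xOpen z q ^ a ∈ InfRing z q :=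
      yInv_pow_mul_xOpen_pow_mem z (by nlinarith)
    have h2 : yInv z q ^ q * xOpen z q ^ 1 ∈ InfRing z q :=
      yInv_pow_mul_xOpen_pow_mem z (by nlinarith)
    have h3 : yInv z q ^ q * xOpen z q ^ 0 ∈ InfRing z q :=
      yInv_pow_mul_xOpen_pow_mem z (by nlinarith)
    rw [pow_one] at h2
    rw [pow_zero, mul_one] at h3
    -- With `v = y^(-q)` and `w = x y^(-q)`, both regular at infinity, `v dw - w dv = y^(-2q) dx`.
    have := Submodule.sub_mem _ (smul_D_mem_range_resInf z (mul_mem h1 h3) h2)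
      (smul_D_mem_range_resInf z (mul_mem h1 h2) h3)
    convert this using 1
    rw [Derivation.leibniz, smul_add, smul_smul, smul_smul, pow_add, pow_add,
      show yInv z q ^ m * xOpen z q ^ a * (yInv z q ^ q * xOpen z q) =
      yInv z q ^ m * xOpen z q ^ a * yInv z q ^ q * xOpen z q by ring,
      add_sub_cancel_right]
    congr 1
    ring
  | succ e ih =>
    intro a m hpos h
    -- The monomial wanted is `f = y^(s-m) x^(a+1-i)` up to leading order. Shifting the exponents by
    -- `q (i + s)` and `n (i + s)`, that is multiplying by `x^(n(i+s)) y^(-q(i+s))`, which has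
    -- leading coefficient `1` and order zero at infinity, makes them natural numbers.
    obtain ⟨b, hb⟩ : ∃ b, b + s = m + q * (i + s) :=
      ⟨m + q * (i + s) - s, by
        have := Nat.le_mul_of_pos_left s (show 0 < q by omega)
        rw [mul_add]; omega⟩
    obtain ⟨c, hc⟩ : ∃ c, c + i = a + 1 + n * (i + s) :=
      ⟨a + 1 + n * (i + s) - i, by
        have := Nat.le_mul_of_pos_left i (show 0 < n by omega); rw [mul_add]; omega⟩
    have hf : yInv z q ^ b * xOpen z q ^ c ∈ InfRing z q := by
      refine yInv_pow_mul_xOpen_pow_mem z ?_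
      zify at hb hc his hpos ⊢
      have e1 : (n : ℤ) * b - q * c = n * m - q * (a + 1) - 1 := by
        linear_combination (n : ℤ) * hb - q * hc - his
      linarith
    have ht : yInv z q ^ s * xOpen z q ^ i ∈ InfRing z q :=
      yInv_pow_mul_xOpen_pow_mem z (by omega)
    have hdt := smul_D_aeval_mul_yInv_pow z (q := q) (by omega) (X ^ i) s
    rw [map_pow, aeval_X, mul_comm (xOpen z q ^ i)] at hdt
    have hlow : (yInv z q ^ (m + q * (i + s) + q) * aeval (xOpen z q)
        (X ^ a * branchPoly z ^ (i + s + 1) + X ^ c *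
          ((q : R[X]) * derivative (X ^ i) * branchPoly z -
            (s : R[X]) * X ^ i * derivative (branchPoly z)))) •
          KaehlerDifferential.D R _ (xOpen z q) ∈ LinearMap.range (resInf z q) := by
      refine yInv_pow_mul_aeval_smul_mem_of_forall z _ _ fun a' ha' => ?_
      have ha'' : a' < a + n * (i + s + 1) := by
        by_contra! hle
        exact mem_support_iff.1 ha' (exists_lower_degree z (by omega) hi his hc a' hle)
      -- Each remaining term has `n m - q (a + 1)` increased by at least `q`, so the bound `e`
      -- drops.
      have hw : q * (a' + 1) + n * m ≤ n * (m + q * (i + s) + q) + q * a := by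
        have := Nat.mul_le_mul_left q (Nat.succ_le_of_lt ha'')
        nlinarith
      refine ih a' _ ?_ ?_
      · nlinarith
      · nlinarith
    have := Submodule.sub_mem _ hlow (Submodule.smul_mem _ (q : R)
      (smul_D_mem_range_resInf z hf ht))
    convert this using 1
    rw [Nat.cast_smul_eq_nsmul, ← Nat.cast_smul_eq_nsmul (OpenRing z q),
      smul_comm, hdt, smul_smul, ← sub_smul]
    congr 1
    have e1 : yInv z q ^ (m + q * (i + s) + q) = yInv z q ^ b * yInv z q ^ (s + q) := by
      rw [← hb]; ring
    have e2 := aeval_branchPoly_pow_mul_yInv_pow z q m (i + s + 1)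
    rw [mul_add, mul_one, ← add_assoc] at e2
    rw [map_add, map_mul, map_mul, map_pow, map_pow, map_pow, aeval_X, mul_add, mul_left_comm,
      mul_comm (yInv z q ^ (m + q * (i + s) + q)), e2, e1]
    ring

theorem yInv_pow_mul_aeval_smul_mem (hq : 1 < q) (hn : 1 < n) (hqn : Nat.Coprime q n)
    (A : R[X]) (m : ℕ) (h : q * (A.natDegree + 1) < n * m) :
    (yInv z q ^ m * aeval (xOpen z q) A) • KaehlerDifferential.D R _ (xOpen z q) ∈
      LinearMap.range (resInf z q) :=
  yInv_pow_mul_aeval_smul_mem_of_forall z A m fun a ha =>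
    yInv_pow_mul_xOpen_pow_smul_mem z hq hn hqn a m <| lt_of_le_of_lt
      (Nat.mul_le_mul_left _ (Nat.succ_le_succ (le_natDegree_of_mem_supp a ha))) h

/-! ### Regularity on the affine curve -/

variable {z} in
theorem separable_branchPoly (hz : ∀ i j, i ≠ j → IsUnit (z i - z j)) :
    (branchPoly z).Separable :=
  separable_prod' (fun i _ j _ hij => isCoprime_X_sub_C_of_isUnit_sub (hz i j hij))
    fun _ _ => separable_X_sub_C

theorem algebraMap_smul_D_mem_range_resAff (f g : AffRing z q) :
    algebraMap (AffRing z q) (OpenRing z q) f • KaehlerDifferential.D R (OpenRing z q)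
      (algebraMap (AffRing z q) (OpenRing z q) g) ∈ LinearMap.range (resAff z q) :=
  ⟨f • KaehlerDifferential.D R _ g, by rw [← smul_resAff, resAff_D]⟩

/-- From `a P + b P' = 1` and `P' dx = q y^(q-1) dy` one gets `dx / y^(q-1) = a y dx + q b dy`.
Multiply by `y^(q-1-m) A(x)`, which is a function on `W` because `m < q`. -/
theorem yInv_pow_mul_aeval_smul_mem_range_resAff (hz : ∀ i j, i ≠ j → IsUnit (z i - z j))
    (A : R[X]) {m : ℕ} (hm : m < q) :
    (yInv z q ^ m * aeval (xOpen z q) A) • KaehlerDifferential.D R _ (xOpen z q) ∈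
      LinearMap.range (resAff z q) := by
  obtain ⟨a, b, hab⟩ := separable_branchPoly hz
  obtain ⟨p, rfl⟩ : ∃ p, q = p + 1 := ⟨q - 1, by omega⟩
  obtain ⟨l, rfl⟩ : ∃ l, p = m + l := ⟨p - m, by omega⟩
  set q := m + l + 1
  have h1 := algebraMap_smul_D_mem_range_resAff z (q := q)
    (yAff z q ^ l * aeval (xAff z q) A * (aeval (xAff z q) a * yAff z q)) (xAff z q)
  have h2 := algebraMap_smul_D_mem_range_resAff z (q := q)
    (yAff z q ^ l * aeval (xAff z q) A * (aeval (xAff z q) b * q)) (yAff z q)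
  have hadd := Submodule.add_mem _ h1 h2
  convert hadd using 1
  have hy := smul_pow_D_yOpen z q
  rw [show q - 1 = m + l from rfl] at hy
  simp only [map_mul, map_pow, map_natCast, algebraMap_aeval_xAff]
  change _ = (yOpen z q ^ l * _ * (_ * yOpen z q)) • KaehlerDifferential.D R _ (xOpen z q) +
    (yOpen z q ^ l * _ * _) • KaehlerDifferential.D R _ (yOpen z q)
  have hyi := yOpen_pow_mul_yInv_pow z q (m + l)
  have e : ∀ u v : OpenRing z q, yOpen z q ^ l * u * (v * (q : OpenRing z q)) =
      (yOpen z q ^ l * u * v * yInv z q ^ (m + l)) * (q * yOpen z q ^ (m + l)) := by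
    intro u v
    calc _ = yOpen z q ^ l * u * (v * (q : OpenRing z q)) * 1 := by ring
      _ = _ := by rw [← hyi]; ring
  rw [e, mul_smul _ ((q : OpenRing z q) * _), hy, smul_smul, ← add_smul]
  congr 1
  have hab' := congrArg (aeval (xOpen z q)) hab
  rw [map_add, map_mul, map_mul, map_one, aeval_xOpen_branchPoly] at hab'
  calc yInv z q ^ m * aeval (xOpen z q) A
      = yInv z q ^ m * aeval (xOpen z q) A * (yOpen z q ^ l * yInv z q ^ l) * 1 := by
        rw [yOpen_pow_mul_yInv_pow, mul_one, mul_one]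
    _ = yOpen z q ^ l * aeval (xOpen z q) A *
          (aeval (xOpen z q) a * (yOpen z q * (yOpen z q ^ (m + l) * yInv z q ^ (m + l))) +
            aeval (xOpen z q) b * aeval (xOpen z q) (derivative (branchPoly z)) *
              yInv z q ^ (m + l)) := by
        rw [← hab']; ring
    _ = _ := by rw [hyi]; ring

end CyclicCurve

end

noncomputable section

open Polynomial LaurentSeries
open scoped KaehlerDifferential

namespace CyclicCurve

variable {R : Type*} [CommRing R] {n : ℕ} (z : Fin n → R) {q : ℕ}

/-! ### The class of `dx / (y ^ r (x - z_k))` -/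

/-- The polynomial `∏_{i ≠ k} (x - zᵢ)`. -/
def branchCofactor (k : Fin n) : R[X] := ∏ i ∈ Finset.univ.erase k, (X - C (z i))

theorem branchPoly_eq (k : Fin n) : branchPoly z = (X - C (z k)) * branchCofactor z k :=
  (Finset.mul_prod_erase Finset.univ (fun i => X - C (z i)) (Finset.mem_univ k)).symm

theorem eval_branchCofactor (k : Fin n) : (branchCofactor z k).eval (z k) = branchDiff z k := by
  simp [branchCofactor, branchDiff, eval_prod]

theorem eval_derivative_branchPoly (k : Fin n) :
    (derivative (branchPoly z)).eval (z k) = branchDiff z k := by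
  rw [branchPoly_eq z k, derivative_mul, eval_add, eval_mul, eval_mul, eval_branchCofactor]
  simp

theorem subInv_eq (k : Fin n) :
    subInv z q k = yInv z q ^ q * aeval (xOpen z q) (branchCofactor z k) := by
  simp [subInv, branchCofactor, map_prod]

theorem natDegree_branchCofactor_lt (k : Fin n) : (branchCofactor z k).natDegree < n := by
  refine lt_of_le_of_lt ((natDegree_prod_le _ _).trans
    (Finset.sum_le_sum fun i _ => natDegree_X_sub_C_le (z i))) ?_
  have := k.2
  rw [Finset.sum_const, Finset.card_erase_of_mem (Finset.mem_univ k), Finset.card_univ,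
    Fintype.card_fin, smul_eq_mul]
  omega

theorem omegaForm_eq (r : ℕ) (k : Fin n) : omegaForm z q r k =
    (yInv z q ^ (r + q) * aeval (xOpen z q) (branchCofactor z k)) •
      KaehlerDifferential.D R _ (xOpen z q) := by
  rw [omegaForm, subInv_eq, pow_add, mul_assoc]

theorem omegaForm_mem_range_resInf (hq : 1 < q) (hn : 1 < n) (hqn : Nat.Coprime q n) {r : ℕ}
    (hr : 0 < r) (k : Fin n) : omegaForm z q r k ∈ LinearMap.range (resInf z q) := by
  rw [omegaForm_eq]
  refine yInv_pow_mul_aeval_smul_mem z hq hn hqn _ _ ?_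
  have h1 := Nat.mul_le_mul_left q (Nat.succ_le_of_lt (natDegree_branchCofactor_lt z k))
  have h2 : 0 < n * r := Nat.mul_pos (by omega) hr
  refine lt_of_le_of_lt h1 ?_
  rw [mul_add n, mul_comm n q]
  omega

/-- Adding an exact form to `dx / (y ^ r (x - z_k))` makes it regular on the affine curve. -/
theorem omegaForm_add_mem_range_resAff (hz : ∀ i j, i ≠ j → IsUnit (z i - z j)) {r : ℕ}
    (hrq : r < q) (k : Fin n) {u : R} (hu : u * (r * branchDiff z k) = 1) :
    omegaForm z q r k + KaehlerDifferential.D R _ ((q * u : R) •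
        (aeval (xOpen z q) (branchCofactor z k) * yInv z q ^ r)) ∈
      LinearMap.range (resAff z q) := by
  -- `H` is the quotient in `G = C_k + (x - z_k) H`. With `G P' = G^2 + P G'` and `u r C_k = 1`, the
  -- numerator `G + u (q G' P - r G P')` equals `u P (q G' - r H - r G')`. Cancelling `P` against
  -- `y^q` leaves the pole order `r < q`.
  obtain ⟨H, hH⟩ := X_sub_C_dvd_sub_C_eval (a := z k) (p := branchCofactor z k)
  rw [eval_branchCofactor] at hH
  set G := branchCofactor z k with hG
  have hP := branchPoly_eq z k
  have hP' : derivative (branchPoly z) = G + (X - C (z k)) * derivative G := by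
    rw [hP, derivative_mul]
    simp [hG]
  rw [Derivation.map_smul, mul_comm (q : R) u, mul_smul, Nat.cast_smul_eq_nsmul R,
    ← Nat.cast_smul_eq_nsmul (OpenRing z q), smul_D_aeval_mul_yInv_pow z (by omega), omegaForm_eq,
    ← smul_assoc, ← add_smul]
  convert yInv_pow_mul_aeval_smul_mem_range_resAff z hz
    (C u * (q * derivative G - r * H - r * derivative G)) hrq using 2
  rw [← aeval_branchPoly_mul_yInv_pow z q r, ← mul_smul_comm, ← mul_add,
    mul_comm (aeval _ _) (yInv z q ^ _), mul_assoc (yInv z q ^ _)]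
  congr 1
  rw [← map_smul, ← map_add, ← map_mul]
  congr 1
  have hu' := congrArg C hu
  rw [C_mul, C_mul, C_1, C_eq_natCast] at hu'
  rw [smul_eq_C_mul, hP']
  rw [← hG] at hP
  linear_combination (-G) * hu' - C u * r * G * hH + C u * r * (derivative G + H) * hP

/-- The third component is recorded along with the class, because it alone determines the pairing
with a global form. -/
theorem exists_class_omegaForm (hq : 1 < q) (hn : 1 < n) (hqn : Nat.Coprime q n)
    (hz : ∀ i j, i ≠ j → IsUnit (z i - z j)) {r : ℕ} (hr : 0 < r) (hrq : r < q) (k : Fin n)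
    {u : R} (hu : u * (r * branchDiff z k) = 1) :
    ∃ a : Cocycle z q, (a : Cochain z q).2.2 = (q * u : R) •
        (aeval (xOpen z q) (branchCofactor z k) * yInv z q ^ r) ∧
      restrictOpen z q (Submodule.Quotient.mk a) =
        Submodule.Quotient.mk (omegaForm z q r k) := by
  obtain ⟨α, hα⟩ := omegaForm_add_mem_range_resAff z hz hrq k hu
  obtain ⟨β, hβ⟩ := omegaForm_mem_range_resInf z hq hn hqn hr k
  refine ⟨⟨(α, β, _), ?_⟩, rfl, ?_⟩
  · rw [Cocycle, LinearMap.mem_ker, cochainDiff_apply]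
    change resAff z q α - resInf z q β - _ = 0
    rw [hα, hβ, add_sub_cancel_left, sub_self]
  · change Submodule.Quotient.mk (resAff z q α) = _
    rw [hα, Submodule.Quotient.eq, add_sub_cancel_left]
    exact ⟨_, rfl⟩

theorem exists_globalForm_muForm (hq : 1 < q) (hn : 1 < n) (hqn : Nat.Coprime q n)
    (hz : ∀ i j, i ≠ j → IsUnit (z i - z j)) {m j : ℕ} (hmq : m < q) (hj : 0 < j)
    (hjm : q * j < n * m) :
    ∃ μ : GlobalForm z q, resAff z q μ.1.1 = muForm z q m j := by
  have h1 := yInv_pow_mul_aeval_smul_mem_range_resAff z hz (X ^ (j - 1)) hmq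
  have h2 := yInv_pow_mul_xOpen_pow_smul_mem z hq hn hqn (j - 1) m
    (by rwa [Nat.sub_add_cancel hj])
  rw [map_pow, aeval_X] at h1
  obtain ⟨α, hα⟩ := h1
  obtain ⟨β, hβ⟩ := h2
  exact ⟨⟨(α, β), hα.trans hβ.symm⟩, hα⟩

/-! ### The residue at infinity of `x ^ m dx / (x - z_k)` -/

theorem poincare_mk_classOfForm (h : Admissible R n q) (a : Cocycle z q) (μ : GlobalForm z q) :
    poincare z h (Submodule.Quotient.mk a) (classOfForm z q μ) =
      residueInf z h ((a : Cochain z q).2.2 • resAff z q μ.1.1) := by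
  rw [show resAff z q μ.1.1 = resInf z q μ.1.2 from μ.2]
  refine (poincare_mk z h a _).trans ?_
  simp

theorem xOpen_mul_subInv (k : Fin n) : xOpen z q * subInv z q k = 1 + z k • subInv z q k := by
  rw [← sub_mul_subInv z q k, Algebra.smul_def]
  ring

/-- Since `x / (x - z_k) = 1 + z_k / (x - z_k)` is regular at infinity and `1 / x = t^q`, the
function `1 / (x - z_k)` is divisible by `t^q`. -/
theorem coeff_zero_expandInf_subInv (h : Admissible R n q) (k : Fin n) :
    (expandInf z h (subInv z q k)).coeff 0 = 0 := by
  have hmem : subInv z q k ∈ InfRing z q := by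
    rw [subInv_eq]
    refine yInv_pow_mul_aeval_mem z _ ?_
    rw [mul_comm n q]
    exact Nat.mul_le_mul_left _ (natDegree_branchCofactor_lt z k).le
  have hmem' : xOpen z q * subInv z q k ∈ InfRing z q := by
    rw [xOpen_mul_subInv]
    exact add_mem (one_mem _) (Subalgebra.smul_mem _ hmem _)
  obtain ⟨p, hp⟩ := exists_powerSeries_of_mem z h hmem'
  have e : expandInf z h (subInv z q k) =
      HahnSeries.single (q : ℤ) 1 * HahnSeries.ofPowerSeries ℤ R p := by
    rw [← hp, map_mul, expandInf_x, xExp, ← mul_assoc, HahnSeries.single_mul_single]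
    simp
  have hq := h.pos
  rw [e, show (0 : ℤ) = -(q : ℤ) + q by ring, HahnSeries.coeff_single_mul_add, one_mul,
    PowerSeries.coeff_coe, if_pos (by omega)]

/-- The geometric series in `z_k / x`, obtained by iterating `x / (x - z_k) = 1 + z_k / (x - z_k)`.
Positive powers of `x` have no constant coefficient. -/
theorem coeff_zero_expandInf_xOpen_pow_mul_subInv (h : Admissible R n q) (k : Fin n) (m : ℕ) :
    (expandInf z h (xOpen z q ^ (m + 1) * subInv z q k)).coeff 0 = z k ^ m := by
  have step : ∀ m : ℕ, (expandInf z h (xOpen z q ^ (m + 1) * subInv z q k)).coeff 0 =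
      (xExp R q ^ m).coeff 0 + z k * (expandInf z h (xOpen z q ^ m * subInv z q k)).coeff 0 := by
    intro m
    rw [pow_succ, mul_assoc, xOpen_mul_subInv, mul_add, mul_one, mul_smul_comm, map_add,
      expandInf_smul, map_pow, expandInf_x]
    simp
  induction m with
  | zero => rw [step]; simp [coeff_zero_expandInf_subInv]
  | succ m ih =>
    have := h.pos
    rw [step, ih, xExp, HahnSeries.single_pow, HahnSeries.coeff_single_of_ne, zero_add, pow_succ']
    have : (0 : ℤ) < (m + 1) * q := by positivity
    simp only [nsmul_eq_mul, mul_neg, Nat.cast_succ]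
    omega

/-- Because `x = t^(-q)`, one has `dx = -q x dt / t`: the factor `q` is the ramification index, the
sign comes from `x` having a pole. -/
theorem residueInf_xOpen_pow_mul_subInv_smul (h : Admissible R n q) (k : Fin n) (m : ℕ) :
    residueInf z h ((xOpen z q ^ m * subInv z q k) • KaehlerDifferential.D R _ (xOpen z q)) =
      -(q * z k ^ m) := by
  rw [residueInf_smul_D, expandInf_x, euler_xExp, ← expandInf_x z h,
    ← coeff_zero_expandInf_xOpen_pow_mul_subInv z h k m]
  rw [show expandInf z h (xOpen z q ^ m * subInv z q k) *
      -((q : R⸨X⸩) * expandInf z h (xOpen z q)) =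
      -(q • expandInf z h (xOpen z q ^ (m + 1) * subInv z q k)) by
    rw [nsmul_eq_mul, pow_succ]; simp only [map_mul]; ring]
  rw [HahnSeries.coeff_neg, HahnSeries.coeff_nsmul, Pi.smul_apply, nsmul_eq_mul]

/-- The exponents `r` and `q - r` add up to `q`, and `G y^(-q) = 1 / (x - z_k)`. -/
theorem residueInf_smul_muForm (h : Admissible R n q) {r : ℕ} (hrq : r < q) (k : Fin n) (j : ℕ)
    (u : R) :
    residueInf z h ((u • (aeval (xOpen z q) (branchCofactor z k) * yInv z q ^ r)) •
      muForm z q (q - r) j) = -(u * q * z k ^ (j - 1)) := by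
  have e : aeval (xOpen z q) (branchCofactor z k) * yInv z q ^ r *
      (yInv z q ^ (q - r) * xOpen z q ^ (j - 1)) = xOpen z q ^ (j - 1) * subInv z q k := by
    rw [subInv_eq, show yInv z q ^ q = yInv z q ^ r * yInv z q ^ (q - r) by
      rw [← pow_add, Nat.add_sub_cancel' hrq.le]]
    ring
  rw [muForm, smul_smul, smul_mul_assoc, e, smul_assoc, map_smul,
    residueInf_xOpen_pow_mul_subInv_smul, smul_eq_mul]
  ring

end CyclicCurve

end

noncomputable section

open Polynomial LaurentSeries
open scoped KaehlerDifferential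

namespace CyclicCurve

variable {R : Type*} [CommRing R]

/-! ### Logarithmic expansion of forms -/

section LogForm

variable {A : Type*} [CommRing A] [Algebra R A] (φ : A →+* R⸨X⸩)
  (hφ : ∀ r, φ (algebraMap R A r) = HahnSeries.C r)

theorem map_smul_of_map_algebraMap {A : Type*} [CommRing A] [Algebra R A] (φ : A →+* R⸨X⸩)
    (hφ : ∀ r, φ (algebraMap R A r) = HahnSeries.C r) (r : R) (f : A) : φ (r • f) = r • φ f := by
  rw [Algebra.smul_def, map_mul, hφ, HahnSeries.C_mul_eq_smul]

theorem isScalarTower_compHom {A : Type*} [CommRing A] [Algebra R A] (φ : A →+* R⸨X⸩)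
    (hφ : ∀ r, φ (algebraMap R A r) = HahnSeries.C r) :
    letI : Module A R⸨X⸩ := Module.compHom _ φ
    IsScalarTower R A R⸨X⸩ :=
  letI : Module A R⸨X⸩ := Module.compHom _ φ
  ⟨fun r f F => by
    change φ (r • f) * F = r • (φ f * F)
    rw [map_smul_of_map_algebraMap φ hφ, ← HahnSeries.C_mul_eq_smul, ← HahnSeries.C_mul_eq_smul,
      mul_assoc]⟩

/-- For an expansion homomorphism `φ : A → R((t))`, the expansion `F` of `1`-forms on `A` such
that a form `ω` expands as `F dt / t`. -/
def logForm : Ω[A⁄R] →ₗ[R] R⸨X⸩ :=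
  letI : Module A R⸨X⸩ := Module.compHom _ φ
  haveI : IsScalarTower R A R⸨X⸩ := isScalarTower_compHom φ hφ
  (Derivation.liftKaehlerDifferential
    (Derivation.mk'
      { toFun := fun f => euler R (φ f)
        map_add' := fun f g => by simp
        map_smul' := fun r f => by simp [map_smul_of_map_algebraMap φ hφ] }
      (fun f g => by
        change euler R (φ (f * g)) = φ f * euler R (φ g) + φ g * euler R (φ f)
        rw [map_mul, euler_mul]) : Derivation R A R⸨X⸩)).restrictScalars R

theorem logForm_smul (f : A) (ω : Ω[A⁄R]) : logForm φ hφ (f • ω) = φ f * logForm φ hφ ω := by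
  let _ : Module A R⸨X⸩ := Module.compHom _ φ
  have : IsScalarTower R A R⸨X⸩ := isScalarTower_compHom φ hφ
  rw [logForm, LinearMap.restrictScalars_apply, map_smul]
  rfl

theorem logForm_D (f : A) :
    logForm φ hφ (KaehlerDifferential.D R A f) = euler R (φ f) := by
  let _ : Module A R⸨X⸩ := Module.compHom _ φ
  have : IsScalarTower R A R⸨X⸩ := isScalarTower_compHom φ hφ
  rw [logForm, LinearMap.restrictScalars_apply, Derivation.liftKaehlerDifferential_comp_D]
  rfl

end LogForm

/-- The factor `PowerSeries.X` records that `t d/dt` kills the constant term, so that regular forms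
have zero residue. -/
theorem euler_ofPowerSeries (p : PowerSeries R) : ∃ s : PowerSeries R,
    euler R (HahnSeries.ofPowerSeries ℤ R p) = HahnSeries.ofPowerSeries ℤ R (PowerSeries.X * s) := by
  refine ⟨PowerSeries.derivative R p, ?_⟩
  ext m
  rw [euler_coeff, PowerSeries.coeff_coe, PowerSeries.coeff_coe]
  split_ifs with hm
  · simp
  · obtain ⟨m, rfl⟩ := Int.eq_ofNat_of_zero_le (not_lt.1 hm)
    cases m with
    | zero => simp
    | succ m =>
      rw [Int.natAbs_natCast, PowerSeries.coeff_succ_X_mul]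
      simp [PowerSeries.coeff_derivative, mul_comm]

/-- Regular forms have expansions without pole and without residue. -/
theorem logForm_map_eq_ofPowerSeries {A B : Type*} [CommRing A] [Algebra R A] [CommRing B]
    [Algebra R B] [Algebra B A] [IsScalarTower R B A] (φ : A →+* R⸨X⸩)
    (hC : ∀ r, φ (algebraMap R A r) = HahnSeries.C r)
    (hφ : ∀ f : B, ∃ p, φ (algebraMap B A f) = HahnSeries.ofPowerSeries ℤ R p) (ω : Ω[B⁄R]) :
    ∃ s : PowerSeries R, logForm φ hC (KaehlerDifferential.map R R B A ω) =
      HahnSeries.ofPowerSeries ℤ R (PowerSeries.X * s) := by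
  have hω : ω ∈ Submodule.span B (Set.range (KaehlerDifferential.D R B)) := by
    rw [KaehlerDifferential.span_range_derivation]
    trivial
  induction hω using Submodule.span_induction with
  | zero => exact ⟨0, by simp⟩
  | add u v _ _ hu hv =>
    obtain ⟨s, hs⟩ := hu
    obtain ⟨t, ht⟩ := hv
    exact ⟨s + t, by rw [map_add, map_add, hs, ht, mul_add, map_add]⟩
  | mem u hu =>
    obtain ⟨g, rfl⟩ := hu
    obtain ⟨p, hp⟩ := hφ g
    obtain ⟨s, hs⟩ := euler_ofPowerSeries p
    exact ⟨s, by rw [KaehlerDifferential.map_D, logForm_D, hp, hs]⟩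
  | smul f u _ hu =>
    obtain ⟨s, hs⟩ := hu
    obtain ⟨p, hp⟩ := hφ f
    refine ⟨p * s, ?_⟩
    rw [map_smul, ← algebraMap_smul A f, logForm_smul, hs, hp, ← map_mul, mul_left_comm]

/-- In characteristic zero, a series whose derivative has no pole has no pole. -/
theorem eq_ofPowerSeries_of_euler [IsDomain R] [CharZero R] {F : R⸨X⸩} {p : PowerSeries R}
    (h : euler R F = HahnSeries.ofPowerSeries ℤ R p) :
    ∃ s : PowerSeries R, F = HahnSeries.ofPowerSeries ℤ R s := by
  refine ⟨PowerSeries.mk fun m => F.coeff m, ?_⟩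
  ext m
  rw [PowerSeries.coeff_coe]
  split_ifs with hm
  · have := congrArg (fun G => HahnSeries.coeff G m) h
    simp only [euler_coeff, PowerSeries.coeff_coe, if_pos hm, mul_eq_zero] at this
    exact this.resolve_left (by exact_mod_cast hm.ne)
  · rw [PowerSeries.coeff_mk, Int.natAbs_of_nonneg (not_lt.1 hm)]

variable {n : ℕ} (z : Fin n → R) {q : ℕ}

theorem residueInf_eq_logForm (h : Admissible R n q) (ω : Ω[OpenRing z q⁄R]) :
    residueInf z h ω = (logForm (expandInf z h) (expandInf_algebraMap z h) ω).coeff 0 := rfl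

theorem exists_logForm_resInf (h : Admissible R n q) (β : Ω[InfRing z q⁄R]) :
    ∃ s : PowerSeries R, logForm (expandInf z h) (expandInf_algebraMap z h) (resInf z q β) =
      HahnSeries.ofPowerSeries ℤ R (PowerSeries.X * s) :=
  logForm_map_eq_ofPowerSeries _ _ (fun f : InfRing z q => exists_powerSeries_of_mem z h f.2) β

/-- Unlike in `residueInf_smul_resInf`, `f` need not be known to lie in `InfRing`. Absence of a pole
in the expansion is all that integrating a regular form provides. -/
theorem residueInf_smul_resInf_of_expandInf (h : Admissible R n q) {f : OpenRing z q}
    {p : PowerSeries R} (hf : expandInf z h f = HahnSeries.ofPowerSeries ℤ R p)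
    (β : Ω[InfRing z q⁄R]) : residueInf z h (f • resInf z q β) = 0 := by
  obtain ⟨s, hs⟩ := exists_logForm_resInf z h β
  rw [residueInf_eq_logForm, logForm_smul, hf, hs, ← map_mul, PowerSeries.coeff_coe]
  simp

/-! ### Expansion at the finite branch points -/

/-- Hensel's lemma for `P(w) = t^q` at the simple root `z_k` of `P`, where `P'(z_k) = C_k` is a
unit. It makes `y = t` a parameter at `D_k`, with `x = w(t)`. -/
theorem exists_branchSeries (hq : 0 < q) (k : Fin n) (hk : IsUnit (branchDiff z k)) :
    ∃ w : PowerSeries R, eval₂ PowerSeries.C w (branchPoly z) = PowerSeries.X ^ q ∧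
      PowerSeries.constantCoeff w = z k := by
  have hH : HenselianRing (PowerSeries R) (Ideal.span {(PowerSeries.X : PowerSeries R)}) :=
    inferInstance
  -- The Henselian property is formulated for monic polynomials. Subtracting the constant `t^q`
  -- keeps `P` monic because its degree `n` is positive, `Fin n` being inhabited by `k`.
  have hdeg : ((branchPoly z).map (PowerSeries.C (R := R)) - C (PowerSeries.X ^ q)).Monic := by
    nontriviality R
    refine ((monic_branchPoly z).map _).sub_of_left (degree_C_le.trans_lt ?_)
    rw [← natDegree_pos_iff_degree_pos, (monic_branchPoly z).natDegree_map, branchPoly,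
      natDegree_finsetProd_X_sub_C_eq_card, Finset.card_univ, Fintype.card_fin]
    exact k.pos
  obtain ⟨w, hw, hw1⟩ := hH.is_henselian _ hdeg (PowerSeries.C (z k))
    (by
      rw [eval_sub, eval_C, eval_map, eval₂_hom, branchPoly_eq z k, Ideal.mem_span_singleton,
        PowerSeries.X_dvd_iff]
      simp [hq.ne'])
    (by
      rw [derivative_sub, derivative_C, sub_zero, derivative_map, eval_map, eval₂_hom,
        eval_derivative_branchPoly]
      exact (hk.map PowerSeries.C).map _)
  refine ⟨w, ?_, ?_⟩
  · rwa [IsRoot, eval_sub, eval_C, eval_map, sub_eq_zero] at hw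
  · rw [Ideal.mem_span_singleton, PowerSeries.X_dvd_iff] at hw1
    simpa [sub_eq_zero] using hw1

variable (q) in
/-- At each `D_k` there is an expansion of functions on `X°` in Laurent series in `y`,
under which functions on `W` become power series whose constant term is their
value at `D_k`. -/
theorem exists_expansion_branch (hq : 0 < q) (k : Fin n) (hk : IsUnit (branchDiff z k)) :
    ∃ (ψ : AffRing z q →+* PowerSeries R) (φ : OpenRing z q →+* R⸨X⸩),
      (∀ r, φ (algebraMap R _ r) = HahnSeries.C r) ∧
      (∀ f, φ (algebraMap _ _ f) = HahnSeries.ofPowerSeries ℤ R (ψ f)) ∧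
      ψ (yAff z q) = PowerSeries.X ∧
      ∀ p : R[X], PowerSeries.constantCoeff (ψ (aeval (xAff z q) p)) = p.eval (z k) := by
  obtain ⟨w, hw, hw0⟩ := exists_branchSeries z hq k hk
  let ψ : AffRing z q →+* PowerSeries R :=
    AdjoinRoot.lift (eval₂RingHom PowerSeries.C w) PowerSeries.X (by
      rw [eval₂_sub, eval₂_pow, eval₂_X, eval₂_C, coe_eval₂RingHom, hw, sub_self])
  have hψ : ∀ p, ψ (mkAff z q p) = eval₂ (eval₂RingHom PowerSeries.C w) PowerSeries.X p :=
    fun p => AdjoinRoot.lift_mk _ p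
  have hψy : ψ (yAff z q) = PowerSeries.X := by simp [yAff, hψ]
  have hψx : ψ (xAff z q) = w := by simp [xAff, hψ]
  have hψC : ∀ r, ψ (algebraMap R _ r) = PowerSeries.C r := by simp [algebraMap_aff, hψ]
  let φ : OpenRing z q →+* R⸨X⸩ :=
    IsLocalization.Away.lift (g := (HahnSeries.ofPowerSeries ℤ R).comp ψ) (yAff z q) (by
      rw [RingHom.comp_apply, hψy, HahnSeries.ofPowerSeries_X]
      refine IsUnit.of_mul_eq_one (HahnSeries.single (-1 : ℤ) 1) ?_
      rw [HahnSeries.single_mul_single]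
      simp)
  have hφ : ∀ f, φ (algebraMap _ _ f) = HahnSeries.ofPowerSeries ℤ R (ψ f) :=
    fun f => IsLocalization.Away.lift_eq _ _ _
  refine ⟨ψ, φ, fun r => ?_, hφ, hψy, fun p => ?_⟩
  · rw [IsScalarTower.algebraMap_apply R (AffRing z q), hφ, hψC, HahnSeries.ofPowerSeries_C]
  · induction p using Polynomial.induction_on' with
    | add p r hp hr => simp only [map_add, eval_add, hp, hr]
    | monomial m a =>
      rw [aeval_monomial, map_mul, map_pow, hψx, hψC, map_mul, map_pow, hw0, eval_monomial]
      simp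

/-! ### Functions on `X°` without poles at the finite branch points -/

variable {z}

/-- The differences `z i - z j` being units, the linear factors are pairwise coprime over any base
ring. -/
theorem branchPoly_dvd (hz : ∀ i j, i ≠ j → IsUnit (z i - z j)) {p : R[X]}
    (hp : ∀ k, p.eval (z k) = 0) : branchPoly z ∣ p :=
  Finset.prod_dvd_of_coprime
    (fun i _ j _ hij => isCoprime_X_sub_C_of_isUnit_sub (hz i j hij))
    fun k _ => dvd_iff_isRoot.2 (hp k)

theorem isUnit_branchDiff (hz : ∀ i j, i ≠ j → IsUnit (z i - z j)) (k : Fin n) :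
    IsUnit (branchDiff z k) :=
  (Finset.univ.erase k).prod_induction _ IsUnit (fun _ _ => IsUnit.mul) isUnit_one
    fun i hi => hz k i (Finset.ne_of_mem_erase hi).symm

theorem exists_aeval_add (g : AffRing z q) :
    ∃ (p : R[X]) (g' : AffRing z q), g = aeval (xAff z q) p + yAff z q * g' := by
  obtain ⟨P, rfl⟩ := mkAff_surjective z q g
  refine ⟨P.coeff 0, mkAff z q P.divX, ?_⟩
  conv_lhs => rw [← X_mul_divX_add P]
  rw [map_add, map_mul, add_comm]
  congr 1
  induction P.coeff 0 using Polynomial.induction_on' with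
  | add p r hp hr => rw [C_add, map_add, map_add, hp, hr]
  | monomial m a =>
    rw [aeval_monomial, algebraMap_aff, xAff, ← map_pow, ← map_mul, ← C_pow, ← C_mul,
      C_mul_X_pow_eq_monomial]

/-- A function vanishing at the points `D_k` is divisible by `y`. -/
theorem yAff_dvd (hq : 0 < q) (hz : ∀ i j, i ≠ j → IsUnit (z i - z j)) {g : AffRing z q}
    (ψ : Fin n → AffRing z q →+* PowerSeries R) (hψy : ∀ k, ψ k (yAff z q) = PowerSeries.X)
    (hψ : ∀ k, ∀ p : R[X], PowerSeries.constantCoeff (ψ k (aeval (xAff z q) p)) = p.eval (z k))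
    (hg : ∀ k, PowerSeries.constantCoeff (ψ k g) = 0) : yAff z q ∣ g := by
  obtain ⟨p, g', rfl⟩ := exists_aeval_add g
  -- Modulo `y` the function is `p(x)`, with value `p(z_k)` at `D_k`. So `P` divides `p`, and `P(x)
  -- = y^q`.
  obtain ⟨p', rfl⟩ := branchPoly_dvd hz (p := p) fun k => by
    simpa [hψy, hψ] using hg k
  rw [map_mul, aeval_xAff_branchPoly]
  exact dvd_add (Dvd.dvd.mul_right (dvd_pow_self _ hq.ne') _) (dvd_mul_right _ _)

/-- A function on `X°` without poles along the `D_k` is a function on `W`. -/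
theorem exists_algebraMap_eq (hq : 0 < q) (hz : ∀ i j, i ≠ j → IsUnit (z i - z j))
    (ψ : Fin n → AffRing z q →+* PowerSeries R) (φ : Fin n → OpenRing z q →+* R⸨X⸩)
    (hφ : ∀ k f, φ k (algebraMap _ _ f) = HahnSeries.ofPowerSeries ℤ R (ψ k f))
    (hψy : ∀ k, ψ k (yAff z q) = PowerSeries.X)
    (hψ : ∀ k, ∀ p : R[X], PowerSeries.constantCoeff (ψ k (aeval (xAff z q) p)) = p.eval (z k))
    {f : OpenRing z q} (hf : ∀ k, ∃ s, φ k f = HahnSeries.ofPowerSeries ℤ R s) :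
    ∃ g : AffRing z q, algebraMap _ _ g = f := by
  obtain ⟨m, g, hg⟩ := IsLocalization.Away.surj (yAff z q) f
  induction m generalizing g with
  | zero => exact ⟨g, by rw [← hg, pow_zero, mul_one]⟩
  | succ m ih =>
    -- In `f y^(m+1) = g` the left side vanishes at every `D_k`, since `f` has no pole there. Hence
    -- `y` divides `g`, and one power of `y` cancels.
    obtain ⟨g', rfl⟩ := yAff_dvd hq hz (g := g) ψ hψy hψ fun k => by
      obtain ⟨s, hs⟩ := hf k
      have h1 := congrArg (φ k) hg
      rw [map_mul, map_pow, hφ, hφ, hs, hψy, ← map_pow, ← map_mul] at h1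
      rw [← HahnSeries.ofPowerSeries_injective h1]
      simp
    refine ih g' ?_
    have hu : IsUnit (algebraMap (AffRing z q) (OpenRing z q) (yAff z q)) :=
      IsLocalization.Away.algebraMap_isUnit _
    refine hu.mul_left_cancel ?_
    rw [← map_mul, ← hg]
    ring

/-! ### The pairing depends only on the restriction to the open curve -/

theorem poincare_eq_zero_of_restrictOpen [IsDomain R] [CharZero R] (h : Admissible R n q)
    (hz : ∀ i j, i ≠ j → IsUnit (z i - z j)) {c : H1dR z q} (hc : restrictOpen z q c = 0)
    (μ : GlobalForm z q) : poincare z h c (classOfForm z q μ) = 0 := by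
  obtain ⟨a, rfl⟩ := Submodule.Quotient.mk_surjective _ c
  change Submodule.Quotient.mk (resAff z q (a : Cochain z q).1) = _ at hc
  rw [Submodule.Quotient.mk_eq_zero] at hc
  obtain ⟨f, hf⟩ := hc
  change KaehlerDifferential.D R (OpenRing z q) f = _ at hf
  have hk := isUnit_branchDiff hz
  choose ψ φ hC hφ hψy hψ using fun k => exists_expansion_branch z q h.pos k (hk k)
  -- `df` is the restriction of the form `α` on `W`, so its expansion at each `D_k` has no pole. In
  -- characteristic zero neither has `f`, which is therefore a function `g` on `W`.
  obtain ⟨g, rfl⟩ := exists_algebraMap_eq h.pos hz ψ φ hφ hψy hψ (f := f) fun k => by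
    obtain ⟨s, hs⟩ := logForm_map_eq_ofPowerSeries (φ k) (hC k) (fun f => ⟨_, hφ k f⟩)
      (a : Cochain z q).1
    refine eq_ofPowerSeries_of_euler (p := PowerSeries.X * s) ?_
    rw [← hs, ← logForm_D (φ k) (hC k), hf]
    rfl
  obtain ⟨s, hs⟩ := exists_logForm_resInf z h (a : Cochain z q).2.1
  -- The cocycle relation gives `d(γ - g) = (α - β) - α = -β`, which is regular at infinity.
  obtain ⟨p, hp⟩ : ∃ p, expandInf z h ((a : Cochain z q).2.2 - algebraMap _ _ g) =
      HahnSeries.ofPowerSeries ℤ R p := by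
    refine eq_ofPowerSeries_of_euler (p := -(PowerSeries.X * s)) ?_
    rw [← logForm_D (expandInf z h) (expandInf_algebraMap z h), map_sub, hf, cocycle_eq,
      sub_sub_cancel_left, map_neg, hs, map_neg]
  have h1 : residueInf z h (((a : Cochain z q).2.2 - algebraMap _ _ g) • resAff z q μ.1.1) = 0 := by
    rw [show resAff z q μ.1.1 = resInf z q μ.1.2 from μ.2]
    exact residueInf_smul_resInf_of_expandInf z h hp _
  rw [poincare_mk_classOfForm, ← sub_add_cancel (a : Cochain z q).2.2 (algebraMap _ _ g),
    add_smul, map_add, h1, smul_resAff, residueInf_resAff, add_zero]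

/-- Tensoring with `ℚ` localizes at the nonzero integers, so equality there is equality up to
torsion. -/
theorem exists_smul_eq_of_restrictsTo {c : H1dR z q} {ω : Ω[OpenRing z q⁄R]}
    (h : RestrictsTo z q c ω) :
    ∃ m : ℤ, m ≠ 0 ∧ m • restrictOpen z q c = m • Submodule.Quotient.mk ω := by
  obtain ⟨m, hm⟩ := (IsLocalizedModule.eq_iff_exists (nonZeroDivisors ℤ)
    (TensorProduct.mk ℤ ℚ (H1dROpen z q) 1)).1 h
  exact ⟨m, nonZeroDivisors.ne_zero m.2, hm⟩

/-- A nonzero integer multiple of `c - c'` restricts to zero on `X°`. The pairing takes values in a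
domain of characteristic zero, where that integer cancels. -/
theorem poincare_eq_of_restrictsTo [IsDomain R] [CharZero R] (h : Admissible R n q)
    (hz : ∀ i j, i ≠ j → IsUnit (z i - z j)) {c c' : H1dR z q} {ω : Ω[OpenRing z q⁄R]}
    (hc : RestrictsTo z q c ω) (hc' : restrictOpen z q c' = Submodule.Quotient.mk ω)
    (μ : GlobalForm z q) :
    poincare z h c (classOfForm z q μ) = poincare z h c' (classOfForm z q μ) := by
  obtain ⟨m, hm, hcm⟩ := exists_smul_eq_of_restrictsTo hc
  have h0 := poincare_eq_zero_of_restrictOpen h hz (c := m • (c - c'))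
    (by rw [map_zsmul, map_sub, hc', smul_sub, hcm, sub_self]) μ
  rw [map_zsmul, map_sub, LinearMap.smul_apply, LinearMap.sub_apply, smul_eq_zero] at h0
  exact sub_eq_zero.1 (h0.resolve_left hm)

end CyclicCurve

end

noncomputable section

open Polynomial LaurentSeries
open scoped KaehlerDifferential

namespace CyclicCurve

/-! ### The universal base -/

/-- A vanishing factor `q a = n r` would force `q ∣ r` by coprimality, against `0 < r < q`. -/
theorem basisFactor_ne_zero {n q r : ℕ} (hqn : Nat.Coprime q n) (hr : 0 < r) (hrq : r < q) :
    basisFactor n q r ≠ 0 := by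
  refine Finset.prod_ne_zero_iff.2 fun a _ h0 => ?_
  have h1 : q * a = n * r := by exact_mod_cast sub_eq_zero.1 h0
  exact absurd (Nat.le_of_dvd hr (hqn.dvd_of_dvd_mul_left ⟨a, h1.symm⟩)) (not_le.2 hrq)

/-- The factor at `a = 0` is `-n r`. This is why `r` is invertible on the base. -/
theorem natCast_dvd_basisFactor (n q r : ℕ) : (r : ℤ) ∣ basisFactor n q r :=
  Dvd.dvd.trans ⟨-(n : ℤ), by push_cast; ring⟩
    (Finset.dvd_prod_of_mem _ (Finset.mem_range.2 (Nat.succ_pos (r * n / q))))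

theorem baseElement_ne_zero {n q r : ℕ} (hn : 0 < n) (hqn : Nat.Coprime q n) (hr : 0 < r)
    (hrq : r < q) : baseElement n q r ≠ 0 := by
  refine mul_ne_zero ?_ (Finset.prod_ne_zero_iff.2 fun i _ => Finset.prod_ne_zero_iff.2
    fun j hj => sub_ne_zero.2 fun h => (Finset.mem_Ioi.1 hj).ne (MvPolynomial.X_injective h))
  rw [Ne, MvPolynomial.C_eq_zero]
  have hq : 0 < q := hr.trans hrq
  exact mul_ne_zero (by positivity) (basisFactor_ne_zero hqn hr hrq)

theorem isUnit_algebraMap_of_dvd_baseElement {n q r : ℕ} (R : Type*) [CommRing R]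
    [Algebra (MvPolynomial (Fin n) ℤ) R] [IsLocalization.Away (baseElement n q r) R]
    {f : MvPolynomial (Fin n) ℤ}
    (hf : f ∣ baseElement n q r) : IsUnit (algebraMap (MvPolynomial (Fin n) ℤ) R f) :=
  isUnit_of_dvd_unit (map_dvd _ hf) (IsLocalization.Away.algebraMap_isUnit (baseElement n q r))

theorem isUnit_coord_sub {n : ℕ} (q r : ℕ) (R : Type*) [CommRing R]
    [Algebra (MvPolynomial (Fin n) ℤ) R] [IsLocalization.Away (baseElement n q r) R]
    {i j : Fin n} (hij : i ≠ j) : IsUnit (coord n R i - coord n R j) := by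
  have key : ∀ i j : Fin n, i < j → IsUnit (coord n R i - coord n R j) := fun i j hij => by
    rw [coord, coord, ← map_sub]
    refine isUnit_algebraMap_of_dvd_baseElement (q := q) (r := r) R (Dvd.dvd.mul_left ?_ _)
    exact (Finset.dvd_prod_of_mem (fun j => MvPolynomial.X i - MvPolynomial.X j)
      (Finset.mem_Ioi.2 hij)).trans
      (Finset.dvd_prod_of_mem (fun i : Fin n => ∏ j ∈ Finset.Ioi i,
        (MvPolynomial.X i - MvPolynomial.X j : MvPolynomial (Fin n) ℤ)) (Finset.mem_univ i))
  rcases hij.lt_or_gt with h | h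
  · exact key i j h
  · rw [← neg_sub]
    exact (key j i h).neg

theorem isUnit_natCast_of_base (n q r : ℕ) (R : Type*) [CommRing R]
    [Algebra (MvPolynomial (Fin n) ℤ) R] [IsLocalization.Away (baseElement n q r) R] :
    IsUnit (r : R) := by
  have := isUnit_algebraMap_of_dvd_baseElement (q := q) (r := r) R
    (f := MvPolynomial.C (r : ℤ)) (Dvd.dvd.mul_right (_root_.map_dvd MvPolynomial.C
      ((natCast_dvd_basisFactor n q r).mul_left _)) _)
  simpa using this

theorem isDomain_of_base {n q r : ℕ} (R : Type*) [CommRing R]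
    [Algebra (MvPolynomial (Fin n) ℤ) R] [IsLocalization.Away (baseElement n q r) R]
    (h0 : baseElement n q r ≠ 0) : IsDomain R :=
  IsLocalization.isDomain_of_le_nonZeroDivisors (M := Submonoid.powers (baseElement n q r)) R
    (powers_le_nonZeroDivisors_of_noZeroDivisors h0)

theorem charZero_of_base {n q r : ℕ} (R : Type*) [CommRing R]
    [Algebra (MvPolynomial (Fin n) ℤ) R] [IsLocalization.Away (baseElement n q r) R]
    (h0 : baseElement n q r ≠ 0) : CharZero R :=
  charZero_of_injective_algebraMap (IsLocalization.injective
    (M := Submonoid.powers (baseElement n q r)) R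
    (powers_le_nonZeroDivisors_of_noZeroDivisors h0))

end CyclicCurve

end

/-! ### The theorem over the universal base -/

theorem mainTheorem10 (n q r : ℕ) (hn : 1 < n) (hq : 0 < q) (hqn : Nat.Coprime q n)
    (hr : 1 ≤ r) (hrq : r < q)
    (R : Type*) [CommRing R] [Algebra (MvPolynomial (Fin n) ℤ) R]
    [IsLocalization.Away (CyclicCurve.baseElement n q r) R]
    (k : Fin n) (j : ℕ) (hj : 1 ≤ j) (hjn : j ≤ n * (q - r) / q) :
    let z : Fin n → R := CyclicCurve.coord n R
    let h : CyclicCurve.Admissible R n q := CyclicCurve.admissible_of_base (r := r) hq hqn R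
    (∃ c : CyclicCurve.H1dR z q,
      CyclicCurve.RestrictsTo z q c (CyclicCurve.omegaForm z q r k)) ∧
    (∃ μ : CyclicCurve.GlobalForm z q,
      CyclicCurve.resAff z q μ.1.1 = CyclicCurve.muForm z q (q - r) j) ∧
    IsUnit ((r : R) * CyclicCurve.branchDiff z k) ∧
    ∀ c : CyclicCurve.H1dR z q,
      CyclicCurve.RestrictsTo z q c (CyclicCurve.omegaForm z q r k) →
    ∀ μ : CyclicCurve.GlobalForm z q,
      CyclicCurve.resAff z q μ.1.1 = CyclicCurve.muForm z q (q - r) j →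
      ((r : R) * CyclicCurve.branchDiff z k) *
          CyclicCurve.poincareP1 z h c (CyclicCurve.classOfForm z q μ) =
        -((q : R) * z k ^ (j - 1)) ∧
      ((r : R) * CyclicCurve.branchDiff z k) *
          CyclicCurve.poincare z h c (CyclicCurve.classOfForm z q μ) =
        -((q : R) ^ 2 * z k ^ (j - 1)) := by
  intro z h
  have h0 := CyclicCurve.baseElement_ne_zero (by omega : 0 < n) hqn hr hrq
  have := CyclicCurve.isDomain_of_base R h0
  have := CyclicCurve.charZero_of_base R h0
  have hz : ∀ i j, i ≠ j → IsUnit (z i - z j) := fun i j =>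
    CyclicCurve.isUnit_coord_sub q r R
  have hu : IsUnit ((r : R) * CyclicCurve.branchDiff z k) :=
    (CyclicCurve.isUnit_natCast_of_base n q r R).mul (CyclicCurve.isUnit_branchDiff hz k)
  obtain ⟨u, hu1⟩ := hu.exists_left_inv
  obtain ⟨a, ha, hares⟩ := CyclicCurve.exists_class_omegaForm z (by omega) hn hqn hz hr hrq k hu1
  -- The floor gives only `q j ≤ n (q - r)`. Equality would make `q` divide `q - r`, which lies
  -- strictly between `0` and `q`. Strictness is what regularity at infinity needs.
  have hjq : q * j < n * (q - r) := by
    refine lt_of_le_of_ne ((mul_comm q j).trans_le ((Nat.le_div_iff_mul_le hq).1 hjn))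
      fun he => ?_
    have := Nat.le_of_dvd (by omega) (hqn.dvd_of_dvd_mul_left ⟨j, he.symm⟩)
    omega
  refine ⟨⟨Submodule.Quotient.mk a, by rw [CyclicCurve.RestrictsTo, hares]⟩,
    CyclicCurve.exists_globalForm_muForm z (by omega) hn hqn hz (by omega) hj hjq, hu,
    fun c hc μ hμ => ?_⟩
  have key : ((r : R) * CyclicCurve.branchDiff z k) *
      CyclicCurve.poincare z h c (CyclicCurve.classOfForm z q μ) =
        -((q : R) ^ 2 * z k ^ (j - 1)) := by
    -- Replaces the given class by the explicit one, whose pairing with `μ` is the residue of `γ μ`.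
    rw [CyclicCurve.poincare_eq_of_restrictsTo h hz hc hares,
      CyclicCurve.poincare_mk_classOfForm, hμ, ha,
      CyclicCurve.residueInf_smul_muForm z h hrq]
    linear_combination (-(q : R) ^ 2 * z k ^ (j - 1)) * hu1
  refine ⟨?_, key⟩
  rw [CyclicCurve.poincareP1, LinearMap.smul_apply, LinearMap.smul_apply, smul_eq_mul,
    mul_left_comm, key]
  have hqu : ((h.isUnit.unit⁻¹ : Rˣ) : R) * q = 1 := h.isUnit.val_inv_mul
  linear_combination (-(q : R) * z k ^ (j - 1)) * hqu
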